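/- Let $M\subset\mathbb C^k$ be a compact set and let $\nu$ be a Borel probability measure on $M$ (for instance normalized Lebesgue measure, when $M$ has positive volume). Let $\overline{\nu}=\nu\times\nu\times\cdots$ be the product measure on $X=M\times M\times\cdots$. For $\lambda\in M$ let $$H_\lambda=H_\lambda^{(q)}\circ\cdots\circ H_\lambda^{(1)}:\mathbb C^2\to\mathbb C^2,\qquad H^{(j)}_\lambda(x,y)=(y,\;p_{j,\lambda}(y)-a_j(\lambda)x),$$ where $q\ge 1$, each $p_{j,\lambda}$ is a monic polynomial of degree $d_j\ge 2$ independent of $\lambda$, the coefficients of $p_{j,\lambda}$ and $a_j(\lambda)$ are continuous functions of $\lambda\in M$, and $a_j(\lambda)\neq 0$ for all $\lambda$. Put $d=d_1\cdots d_q$. For $\Lambda=(\lambda_1,\lambda_2,\ldots)\in X$ and $n\ge 0$ let $$H^{\pm}_{n,\Lambda}=H_{\lambda_n}^{\pm1}\circ\cdots\circ H_{\lambda_1}^{\pm1},\qquad G^{\pm}_\Lambda(z)=\lim_{n\to\infty}\frac1{d^n}\log^+\Vert H^{\pm}_{n,\Lambda}(z)\Vert ,$$ $$K^{\pm}_\Lambda=\{z\in\mathbb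 C^2:\ (H^{\pm}_{n,\Lambda}(z))_{n\ge0}\text{ is bounded}\},\qquad EG^{\pm}(z)=\int_X G^{\pm}_\Lambda(z)\,d\overline{\nu}(\Lambda).$$ Then, for each choice of sign, the limit $G^\pm_\Lambda(z)$ exists for all $\Lambda\in X$ and $z\in\mathbb C^2$, the function $\Lambda\mapsto G^\pm_\Lambda(z)$ is $\overline{\nu}$-integrable for every $z$, and: 1. $EG^{\pm}$ is a locally Hölder continuous plurisubharmonic function on $\mathbb C^2$. 2. $EG^{\pm}$ is strictly positive and pluriharmonic on $\mathbb C^2\setminus\overline{\bigcup_{\Lambda\in X}K^{\pm}_\Lambda}$. 3. $EG^{\pm}$ vanishes on $\bigcap_{\Lambda\in X}K^{\pm}_\Lambda$; and if $\nu$ has full support (every nonempty relatively open subset of $M$ has positive $\nu$-measure), then $EG^{\pm}$ vanishes precisely on $\bigcap_{\Lambda\in X}K^{\pm}_\Lambda$. -/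

import Mathlib

open MeasureTheory Filter Topology Polynomial

noncomputable section

namespace RandomHenon

/-- The space `ℂ²` with its Euclidean norm. -/
abbrev C2 : Type := EuclideanSpace ℂ (Fin 2)

/-- The generalized Hénon map `(x, y) ↦ (y, p(y) - a x)` with `a ≠ 0`, as a bijection of `ℂ²`;
its inverse is `(x, y) ↦ ((p(x) - y) / a, x)`. -/
def henonMap (p : ℂ[X]) (a : ℂ) (ha : a ≠ 0) : Equiv.Perm C2 where
  toFun z := !₂[z 1, p.eval (z 1) - a * z 0]
  invFun z := !₂[(p.eval (z 0) - z 1) / a, z 0]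
  left_inv z := by
    ext i
    fin_cases i
    · simp [ha]
    · simp
  right_inv z := by
    ext i
    fin_cases i
    · simp
    · simp [mul_div_cancel₀ _ ha]

/-- A continuous family of compositions of `m ≥ 1` generalized Hénon maps, parametrized by `P`:
the `j`-th factor at the parameter `t` is `(x, y) ↦ (y, p j t (y) - a j t * x)`, where `p j t` is
monic of degree `deg j ≥ 2` (independent of `t`), its coefficients and `a j t` depend continuously
on `t`, and `a j t ≠ 0`. -/
structure HenonFamily (P : Type*) [TopologicalSpace P] where
  m : ℕ
  m_pos : 0 < m
  deg : Fin m → ℕ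
  two_le_deg : ∀ j, 2 ≤ deg j
  p : Fin m → P → ℂ[X]
  monic : ∀ j t, (p j t).Monic
  natDegree_eq : ∀ j t, (p j t).natDegree = deg j
  continuous_coeff : ∀ j i, Continuous fun t => (p j t).coeff i
  a : Fin m → P → ℂ
  continuous_a : ∀ j, Continuous (a j)
  a_ne_zero : ∀ j t, a j t ≠ 0

namespace HenonFamily

variable {P : Type*} [TopologicalSpace P] (F : HenonFamily P)

/-- The degree `d = d₁ d₂ ⋯ d_m`. -/
def degree : ℕ := ∏ j, F.deg j

/-- The `j`-th factor of the map with parameter `t`. -/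
def factor (t : P) (j : Fin F.m) : Equiv.Perm C2 :=
  henonMap (F.p j t) (F.a j t) (F.a_ne_zero j t)

/-- `H_t = H_t^{(m)} ∘ ⋯ ∘ H_t^{(1)}` (the product in `Equiv.Perm` is composition). -/
def map (t : P) : Equiv.Perm C2 := (List.ofFn (F.factor t)).reverse.prod

/-- For `Λ = (Λ 0, Λ 1, …)` and a sign `ε = ±1`, the random iterate
`H_{Λ (n-1)}^ε ∘ ⋯ ∘ H_{Λ 0}^ε`. -/
def iter (ε : ℤˣ) (Λ : ℕ → P) : ℕ → Equiv.Perm C2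
  | 0 => 1
  | n + 1 => F.map (Λ n) ^ (ε : ℤ) * iter ε Λ n

/-- The set `K^±_Λ` of points with bounded random orbit. -/
def nonescaping (ε : ℤˣ) (Λ : ℕ → P) : Set C2 :=
  {z | Bornology.IsBounded (Set.range fun n => F.iter ε Λ n z)}

/-- `G^±_{n,Λ}(z) = d⁻ⁿ log⁺ ‖H^±_{n,Λ}(z)‖`. -/
def greenApprox (ε : ℤˣ) (Λ : ℕ → P) (n : ℕ) (z : C2) : ℝ :=
  1 / (F.degree : ℝ) ^ n * Real.posLog ‖F.iter ε Λ n z‖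

/-- The random Green function `G^±_Λ = lim G^±_{n,Λ}`. -/
def green (ε : ℤˣ) (Λ : ℕ → P) (z : C2) : ℝ :=
  limUnder atTop fun n => F.greenApprox ε Λ n z

/-- The average Green function `EG^±(z) = ∫ G^±_Λ(z) d(ν × ν × ⋯)(Λ)`. -/
def averageGreen [MeasurableSpace P] (ν : Measure P) [IsProbabilityMeasure ν] (ε : ℤˣ) (z : C2) :
    ℝ :=
  ∫ Λ, F.green ε Λ z ∂(Measure.infinitePi fun _ : ℕ => ν)

end HenonFamily

/-- Local Hölder continuity: near every point the function is Hölder continuous with some exponent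
in `(0, 1]`. -/
def LocallyHolder (u : C2 → ℝ) : Prop :=
  ∀ z, ∃ U ∈ 𝓝 z, ∃ C r : NNReal, 0 < r ∧ r ≤ 1 ∧ HolderOnWith C r u U

/-- A real-valued function on `ℂ²` is plurisubharmonic if it is upper semicontinuous and satisfies
the sub-mean value inequality on every circle `{a + e^{iθ} b}` in a complex line. (Being finite at
the centre, such a function has finite mean over the circle; this is recorded by the integrability
clause.) -/
def Plurisubharmonic (u : C2 → ℝ) : Prop :=
  UpperSemicontinuous u ∧
    ∀ a b : C2, CircleIntegrable (fun ζ : ℂ => u (a + ζ • b)) 0 1 ∧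
      u a ≤ Real.circleAverage (fun ζ : ℂ => u (a + ζ • b)) 0 1

/-- A real-valued function is pluriharmonic on an open set `Ω ⊆ ℂ²` if it is of class `C²` there
and its restriction to every complex line is harmonic. -/
def PluriharmonicOn (u : C2 → ℝ) (Ω : Set C2) : Prop :=
  ContDiffOn ℝ 2 u Ω ∧
    ∀ a ∈ Ω, ∀ b : C2, InnerProductSpace.HarmonicAt (fun ζ : ℂ => u (a + ζ • b)) 0

end RandomHenon

end

/-! Near infinity, both the Hénon maps and their inverses grow like the `D`-th power of one dominant
coordinate (`y` forwards, `x` backwards). `HenonLike` isolates what this gives: an invariant cone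
with growth of degree `D`, a polynomial Lipschitz bound, and confinement of orbits outside the cone.
Compactness of the parameter space makes all constants uniform, and both signs become one case
(`exists_henonLike`).

Along orbits starting in a fixed ball, `log⁺ ‖Φ z‖ = D log⁺ ‖z‖ + O(1)` uniformly in `Λ`. The
approximations therefore converge geometrically (`dist_escapeApprox_le`), and the rate of escape is
jointly continuous in `(Λ, z)`. It vanishes on orbits that never enter the cone, which are the
bounded ones, and is positive on the others.

Hölder continuity is a competition: truncation at time `n` costs `D⁻ⁿ`, while two orbits separate,
relative to their size, at rate at most `Lⁿ` (`norm_orbit_sub_le`). The estimates do not depend on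
`Λ`, so they pass to the mean.

The sub-mean value inequality holds for `log⁺` of the norm of a holomorphic map, hence for the
limit, hence for the mean by Fubini. On a disc of escaping points the orbits lie in the cone from
some time on; there `log⁺` of the norm is the logarithm of a zero-free holomorphic function up to a
bounded error, so the limit satisfies the Poisson formula (`circleAverage_escapeRate`). That formula
also passes to the mean; it yields harmonicity on lines, and the mean value property on all small
circles yields `C²` smoothness.

For the zero set, a single `Λ` with positive escape rate gives a positive mean, by continuity in `Λ`
and full support of the product measure. -/

noncomputable section

namespace RandomHenon

open Metric Set InnerProductSpace

/-! ### Circle averages, Jensen and Poisson formulas, regularity from mean values -/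

/-- Fubini's theorem for circle averages of a bounded family of functions. -/
lemma circleAverage_integral {X : Type*} [MeasurableSpace X] (μ : Measure X) [IsFiniteMeasure μ]
    (f : X → ℂ → ℝ) (C : ℝ)
    (hm : AEStronglyMeasurable (fun p : X × ℝ => f p.1 (circleMap 0 1 p.2))
      (μ.prod (volume.restrict (Ioc 0 (2 * Real.pi)))))
    (hb : ∀ x, ∀ ζ ∈ sphere (0 : ℂ) 1, |f x ζ| ≤ C) :
    Real.circleAverage (fun ζ => ∫ x, f x ζ ∂μ) 0 1
      = ∫ x, Real.circleAverage (f x) 0 1 ∂μ := by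
  have hint : Integrable (fun p : X × ℝ => f p.1 (circleMap 0 1 p.2))
      (μ.prod (volume.restrict (Ioc 0 (2 * Real.pi)))) :=
    Integrable.of_bound hm C (Eventually.of_forall fun p => by
      simpa using hb p.1 _ (circleMap_mem_sphere 0 zero_le_one p.2))
  simp only [Real.circleAverage_def, intervalIntegral.integral_of_le Real.two_pi_pos.le]
  rw [integral_smul]
  congr 1
  exact (integral_integral_swap (f := fun x θ => f x (circleMap 0 1 θ)) hint).symm

/-- Passage to the limit in circle averages. -/
lemma tendsto_circleAverage {f : ℕ → ℂ → ℝ} {g : ℂ → ℝ} (C : ℝ)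
    (hf : ∀ n, ContinuousOn (f n) (sphere 0 1))
    (hb : ∀ n, ∀ ζ ∈ sphere (0 : ℂ) 1, |f n ζ| ≤ C)
    (hlim : ∀ ζ ∈ sphere (0 : ℂ) 1, Tendsto (fun n => f n ζ) atTop (𝓝 (g ζ))) :
    Tendsto (fun n => Real.circleAverage (f n) 0 1) atTop (𝓝 (Real.circleAverage g 0 1)) := by
  simp only [Real.circleAverage_def]
  refine Tendsto.const_smul ?_ _
  refine intervalIntegral.tendsto_integral_filter_of_dominated_convergence (fun _ => C) ?_ ?_ ?_ ?_
  · refine Eventually.of_forall fun n => Continuous.aestronglyMeasurable ?_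
    exact (hf n).comp_continuous (continuous_circleMap 0 1)
      fun θ => circleMap_mem_sphere 0 zero_le_one θ
  · exact Eventually.of_forall fun n => Eventually.of_forall fun θ _ => by
      simpa using hb n _ (circleMap_mem_sphere 0 zero_le_one θ)
  · exact intervalIntegrable_const
  · exact Eventually.of_forall fun θ _ => hlim _ (circleMap_mem_sphere 0 zero_le_one θ)

/-- The sub-mean value inequality for the logarithm of the modulus of an entire function. -/
lemma log_norm_le_circleAverage {f : ℂ → ℂ} (hf : Differentiable ℂ f) (h0 : f 0 ≠ 0) :
    Real.log ‖f 0‖ ≤ Real.circleAverage (fun ζ => Real.log ‖f ζ‖) 0 1 := by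
  have han : AnalyticOnNhd ℂ f (closedBall 0 |1|) := fun x _ => hf.analyticAt x
  -- Jensen's formula: the average exceeds `log ‖f 0‖` by a sum over the zeros in the disc, whose
  -- terms are nonnegative.
  have h := han.circleAverage_log_norm one_ne_zero h0
  have h' : 0 ≤ ∑ᶠ u, MeromorphicOn.divisor f (closedBall 0 |1|) u
      * Real.log (1 * ‖(0 : ℂ) - u‖⁻¹) := by
    refine finsum_nonneg fun u => ?_
    by_cases hu : u ∈ closedBall (0 : ℂ) |1|
    · refine mul_nonneg ?_ ?_
      · exact_mod_cast MeromorphicOn.AnalyticOnNhd.divisor_nonneg han u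
      · rcases eq_or_ne u 0 with rfl | hne
        · simp
        · refine Real.log_nonneg ?_
          rw [one_mul, zero_sub, norm_neg, one_le_inv₀ (norm_pos_iff.2 hne)]
          simpa using hu
    · simp [Function.locallyFinsuppWithin.apply_eq_zero_of_notMem _ hu]
  linarith

/-- The sub-mean value inequality for `log⁺ ‖f‖`, where `f` is a vector valued entire function. -/
lemma posLog_norm_le_circleAverage {f : ℂ → C2} (hf : Differentiable ℂ f) :
    Real.posLog ‖f 0‖ ≤ Real.circleAverage (fun ζ => Real.posLog ‖f ζ‖) 0 1 := by
  have hcont : Continuous fun ζ => Real.posLog ‖f ζ‖ :=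
    Real.continuous_posLog.comp hf.continuous.norm
  have hci : CircleIntegrable (fun ζ => Real.posLog ‖f ζ‖) 0 1 :=
    hcont.continuousOn.circleIntegrable zero_le_one
  rcases le_or_gt ‖f 0‖ 1 with h1 | h1
  · rw [(Real.posLog_eq_zero_iff _).2 (by simpa using h1)]
    exact Real.circleAverage_nonneg_of_nonneg fun _ _ => Real.posLog_nonneg
  · have hpos : 0 < ‖f 0‖ := by linarith
    -- Pairing with the unit vector along `f 0` reduces to a scalar function: `‖⟨v, f⟩‖ ≤ ‖f‖`, with
    -- equality at the centre.
    set v : C2 := ((‖f 0‖⁻¹ : ℝ) : ℂ) • f 0 with hv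
    have hvn : ‖v‖ = 1 := by
      rw [hv, norm_smul]; simp [hpos.ne']
    set φ : ℂ → ℂ := fun ζ => inner ℂ v (f ζ) with hφ
    have hφd : Differentiable ℂ φ := (innerSL ℂ v).differentiable.comp hf
    have hφ0 : ‖φ 0‖ = ‖f 0‖ := by
      simp only [hφ, hv, inner_smul_left, inner_self_eq_norm_sq_to_K]
      simp [pow_two, hpos.ne']
    have hφ0' : φ 0 ≠ 0 := norm_pos_iff.1 (hφ0 ▸ hpos)
    rw [Real.posLog_eq_log (by simpa using h1.le), ← hφ0]
    refine (log_norm_le_circleAverage hφd hφ0').trans (Real.circleAverage_mono ?_ hci ?_)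
    · have hmero : MeromorphicOn φ (sphere 0 |1|) := fun x _ => (hφd.analyticAt x).meromorphicAt
      exact MeromorphicOn.circleIntegrable_log_norm hmero
    · intro ζ _
      have h2 : ‖φ ζ‖ ≤ ‖f ζ‖ := by
        simpa [hvn] using norm_inner_le_norm (𝕜 := ℂ) v (f ζ)
      have h3 : Real.log ‖φ ζ‖ ≤ Real.posLog ‖φ ζ‖ := le_max_right _ _
      exact h3.trans (Real.posLog_le_posLog (norm_nonneg _) h2)

lemma continuousOn_re_herglotzRieszKernel {w : ℂ} (hw : w ∈ ball (0 : ℂ) 1) :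
    ContinuousOn (Complex.re ∘ herglotzRieszKernel 0 w) (sphere 0 1) := by
  refine Complex.continuous_re.comp_continuousOn ?_
  rw [herglotzRieszKernel_fun_def]
  refine ContinuousOn.div (by fun_prop) (by fun_prop) fun z hz h => ?_
  have : z = w := by simpa [sub_eq_zero] using h
  rw [this] at hz
  simp at hz hw
  linarith

/-- A continuous function that satisfies the Poisson formula on the unit disc is the real part of
a holomorphic function near the origin. -/
lemma exists_analyticAt_re_eq_of_poisson {v : ℂ → ℝ} (hv : Continuous v)
    (h : ∀ w ∈ ball (0 : ℂ) 1,
      Real.circleAverage ((Complex.re ∘ herglotzRieszKernel 0 w) • v) 0 1 = v w) :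
    ∃ f : ℂ → ℂ, AnalyticAt ℂ f 0 ∧ v =ᶠ[𝓝 0] fun z => (f z).re := by
  have hvc : Continuous fun z => (v z : ℂ) := Complex.continuous_ofReal.comp hv
  set Q : ℂ → ℂ := fun w => (2 * Real.pi * Complex.I : ℂ)⁻¹ • ∮ z in C(0, (1 : NNReal)),
    (z - w)⁻¹ • (v z : ℂ) with hQ
  have hQa : AnalyticAt ℂ Q 0 :=
    (hasFPowerSeriesOn_cauchy_integral (R := 1)
      (hvc.continuousOn.circleIntegrable (by simp)) one_pos).analyticAt
  set A : ℂ := Real.circleAverage (fun z => (v z : ℂ)) 0 1 with hA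
  -- The Herglotz kernel is `(z + w) / (z - w) = 2 z / (z - w) - 1`, so averaging `v` against it
  -- gives twice the Cauchy transform minus the mean, which is holomorphic in `w`.
  set Fn : ℂ → ℂ := fun w => 2 * Q w - A with hF
  have hFa : AnalyticAt ℂ Fn 0 := (analyticAt_const.mul hQa).sub analyticAt_const
  refine ⟨Fn, hFa, ?_⟩
  filter_upwards [ball_mem_nhds (0 : ℂ) one_pos] with w hw
  rw [← h w hw]
  have hne : ∀ z ∈ sphere (0 : ℂ) 1, z - w ≠ 0 := by
    intro z hz h0
    rw [sub_eq_zero] at h0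
    rw [h0] at hz
    simp at hz hw
    linarith
  have hc1 : CircleIntegrable (fun z => z * (z - w)⁻¹ * (v z : ℂ)) 0 1 := by
    refine ContinuousOn.circleIntegrable zero_le_one ?_
    exact (continuousOn_id.mul (ContinuousOn.inv₀ (by fun_prop) hne)).mul hvc.continuousOn
  have hc2 : CircleIntegrable (fun z => (v z : ℂ)) 0 1 :=
    hvc.continuousOn.circleIntegrable zero_le_one
  have hQ' : Q w = Real.circleAverage (fun z => z * (z - w)⁻¹ * (v z : ℂ)) 0 1 := by
    rw [Real.circleAverage_eq_circleIntegral one_ne_zero, hQ]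
    simp only [NNReal.coe_one]
    congr 1
    refine circleIntegral.integral_congr zero_le_one fun z hz => ?_
    have : z ≠ 0 := by rintro rfl; simp at hz
    simp only [smul_eq_mul, sub_zero]
    field_simp
  have hFw : Fn w = Real.circleAverage (fun z => herglotzRieszKernel 0 w z * (v z : ℂ)) 0 1 := by
    simp only [hF]
    rw [hQ', hA, show (2 : ℂ) * Real.circleAverage (fun z => z * (z - w)⁻¹ * (v z : ℂ)) 0 1
      = (2 : ℂ) • Real.circleAverage (fun z => z * (z - w)⁻¹ * (v z : ℂ)) 0 1 from rfl,
      ← Real.circleAverage_fun_smul, ← Real.circleAverage_fun_sub hc1.const_fun_smul hc2]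
    refine Real.circleAverage_congr_sphere fun z hz => ?_
    have := hne z (by simpa using hz)
    simp only [herglotzRieszKernel_def, smul_eq_mul, sub_zero]
    field_simp
    ring
  rw [hFw]
  have hc3 : CircleIntegrable (fun z => herglotzRieszKernel 0 w z * (v z : ℂ)) 0 1 := by
    refine ContinuousOn.circleIntegrable zero_le_one ?_
    refine ContinuousOn.mul ?_ hvc.continuousOn
    rw [herglotzRieszKernel_fun_def]
    exact ContinuousOn.div (by fun_prop) (by fun_prop) fun z hz => by simpa using hne z hz
  have := Complex.reCLM.circleAverage_comp_comm hc3
  simp only [Complex.reCLM_apply] at this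
  rw [← this]
  congr 1
  ext z
  simp

/-- A continuous function on `ℂ²` that satisfies the mean value property on small circles in
complex lines is of class `C²`. -/
lemma contDiffAt_of_circleAverage_eq {u : C2 → ℝ} (hu : Continuous u) {a₀ : C2} {r : ℝ}
    (hr : 0 < r)
    (h : ∀ a ∈ ball a₀ r, ∀ b : C2, ‖b‖ ≤ r →
      Real.circleAverage (fun ζ : ℂ => u (a + ζ • b)) 0 1 = u a) :
    ContDiffAt ℝ 2 u a₀ := by
  -- A radial bump: invariance under `t ↦ ζ • t` with `‖ζ‖ = 1` lets the convolution be averaged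
  -- over circles, where the hypothesis replaces `u` by its value at the centre. Hence `φ * u = (∫
  -- φ) u` near `a₀`.
  set φ : C2 → ℝ := fun t => Real.smoothTransition (1 - ‖t‖ ^ 2 / r ^ 2) with hφ
  have hφd : ContDiff ℝ 2 φ :=
    Real.smoothTransition.contDiff.comp
      (contDiff_const.sub ((contDiff_norm_sq ℝ).div_const _))
  have hφ0 : ∀ t, t ∉ closedBall (0 : C2) r → φ t = 0 := by
    intro t ht
    refine Real.smoothTransition.zero_of_nonpos ?_
    have : r < ‖t‖ := by simpa using ht
    rw [sub_nonpos, one_le_div (by positivity)]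
    gcongr
  have hφs : HasCompactSupport φ :=
    HasCompactSupport.intro (isCompact_closedBall (0 : C2) r) hφ0
  have hφ1 : ∀ t, |φ t| ≤ 1 := fun t => by
    rw [abs_of_nonneg (Real.smoothTransition.nonneg _)]
    exact Real.smoothTransition.le_one _
  have hφrot : ∀ ζ ∈ sphere (0 : ℂ) 1, ∀ t, φ (ζ • t) = φ t := by
    intro ζ hζ t
    have : ‖ζ‖ = 1 := by simpa using hζ
    simp [hφ, norm_smul, this]
  have hφint : 0 < ∫ t, φ t := by
    refine hφd.continuous.integral_pos_of_hasCompactSupport_nonneg_nonzero hφs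
      (fun t => Real.smoothTransition.nonneg _) (x := 0) ?_
    simp [hφ]
  set S : C2 → ℝ := MeasureTheory.convolution φ u (ContinuousLinearMap.mul ℝ ℝ) volume with hS
  have hSd : ContDiff ℝ 2 S :=
    hφs.contDiff_convolution_left (n := 2) _ hφd hu.locallyIntegrable
  have hSdef : ∀ a, S a = ∫ t, φ t * u (a - t) := fun a => rfl
  have key : ∀ a ∈ ball a₀ r, u a = (∫ t, φ t)⁻¹ * S a := by
    intro a ha
    rw [eq_inv_mul_iff_mul_eq₀ hφint.ne']
    have hset : ∀ ζ : ℂ, ∫ t in closedBall (0 : C2) r, φ t * u (a + ζ • (-t))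
        = ∫ t, φ t * u (a + ζ • (-t)) := fun ζ =>
      setIntegral_eq_integral_of_forall_compl_eq_zero fun t ht => by rw [hφ0 t ht, zero_mul]
    have hrot : ∀ ζ ∈ sphere (0 : ℂ) 1, ∫ t, φ t * u (a + ζ • (-t)) = S a := by
      intro ζ hζ
      have hn : ‖ζ‖ = 1 := by simpa using hζ
      have hζ0 : ζ ≠ 0 := by rintro rfl; simp at hn
      let e : C2 ≃ₗᵢ[ℝ] C2 :=
        { (LinearEquiv.smulOfNeZero ℂ C2 ζ hζ0).restrictScalars ℝ with
          norm_map' := fun x => by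
            change ‖ζ • x‖ = ‖x‖
            rw [norm_smul, hn, one_mul] }
      have he : ∀ x, e x = ζ • x := fun x => rfl
      rw [hSdef, ← e.measurePreserving.integral_comp e.toHomeomorph.measurableEmbedding
        (fun t => φ t * u (a - t))]
      refine integral_congr_ae (Eventually.of_forall fun t => ?_)
      simp only [he, hφrot ζ hζ, smul_neg, sub_eq_add_neg]
    obtain ⟨B, hB⟩ := ((isCompact_closedBall a r).image hu).isBounded.exists_norm_le
    have hcont : Continuous fun p : C2 × ℝ => φ p.1 * u (a + circleMap 0 1 p.2 • (-p.1)) := by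
      have := hφd.continuous
      have h2 := continuous_circleMap 0 1
      fun_prop
    have : IsFiniteMeasure (volume.restrict (closedBall (0 : C2) r)) :=
      ⟨by simpa using (isCompact_closedBall (0 : C2) r).measure_lt_top⟩
    have hfub := circleAverage_integral (volume.restrict (closedBall (0 : C2) r))
      (fun t ζ => φ t * u (a + ζ • (-t))) B hcont.aestronglyMeasurable (by
        intro t ζ hζ
        have hn : ‖ζ‖ = 1 := by simpa using hζ
        have hB0 : 0 ≤ B := (norm_nonneg _).trans (hB (u a) ⟨a, by simp [hr.le], rfl⟩)
        by_cases ht : t ∈ closedBall (0 : C2) r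
        · rw [abs_mul]
          refine (mul_le_mul (hφ1 t) (hB _ ⟨_, ?_, rfl⟩) (abs_nonneg _) zero_le_one).trans
            (one_mul B).le
          simpa [norm_smul, hn] using ht
        · simpa [hφ0 t ht] using hB0)
    simp only [hset] at hfub
    rw [Real.circleAverage_congr_sphere (f₂ := fun _ => S a) (fun ζ hζ => hrot ζ (by simpa using hζ)),
      Real.circleAverage_const] at hfub
    rw [hfub, ← setIntegral_eq_integral_of_forall_compl_eq_zero hφ0, ← integral_mul_const]
    refine setIntegral_congr_fun measurableSet_closedBall fun t ht => ?_
    have := h a ha (-t) (by simpa using ht)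
    rw [← this, ← smul_eq_mul, ← Real.circleAverage_fun_smul]
    rfl
  have : u =ᶠ[𝓝 a₀] fun a => (∫ t, φ t)⁻¹ * S a := by
    filter_upwards [ball_mem_nhds a₀ hr] with a ha using key a ha
  exact (contDiffAt_const.mul hSd.contDiffAt).congr_of_eventuallyEq this

/-! ### The cone filtration and Hénon-like families -/

lemma norm_apply_le_norm (z : C2) (i : Fin 2) : ‖z i‖ ≤ ‖z‖ := PiLp.norm_apply_le z i

lemma norm_le_two_mul {z : C2} {r : ℝ} (h : ∀ i, ‖z i‖ ≤ r) : ‖z‖ ≤ 2 * r := by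
  have hr : 0 ≤ r := (norm_nonneg _).trans (h 0)
  rw [EuclideanSpace.norm_eq, Real.sqrt_le_left (by positivity), Fin.sum_univ_two]
  have h0 := pow_le_pow_left₀ (norm_nonneg _) (h 0) 2
  have h1 := pow_le_pow_left₀ (norm_nonneg _) (h 1) 2
  nlinarith

/-- The set of points whose coordinate with index `s` has modulus at least `R` and dominates the
other coordinate. -/
def cone (s : Fin 2) (R : ℝ) : Set C2 := {z | R ≤ ‖z s‖ ∧ ∀ i, ‖z i‖ ≤ ‖z s‖}

/-- A family of self-maps of `ℂ²` that behaves near infinity like a family of (inverses of)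
generalized Hénon maps of degree `D`, with the filtration given by `cone s R`. -/
structure HenonLike {P : Type*} [TopologicalSpace P] (s : Fin 2) (R : ℝ) (D : ℕ)
    (Φ : P → C2 → C2) : Prop where
  one_le : 1 ≤ D
  continuous : Continuous fun q : P × C2 => Φ q.1 q.2
  differentiable : ∀ t, Differentiable ℂ (Φ t)
  mapsTo : ∀ t, MapsTo (Φ t) (cone s R) (cone s R)
  expand : ∀ t, ∀ z ∈ cone s R, D * ‖z s‖ ≤ ‖Φ t z s‖
  lower : ∃ c > 0, ∀ t, ∀ z ∈ cone s R, c * ‖z s‖ ^ D ≤ ‖Φ t z s‖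
  upper : ∃ C, 1 ≤ C ∧ ∀ t z, max 1 ‖Φ t z‖ ≤ C * max 1 ‖z‖ ^ D
  lipschitz : ∃ C, 0 ≤ C ∧ ∀ t z w,
    ‖Φ t z - Φ t w‖ ≤ C * max 1 (max ‖z‖ ‖w‖) ^ (D - 1) * ‖z - w‖
  -- The same `r` appears before and after, so the bound can be iterated without loss.
  bounded : ∀ t z r, R ≤ r → (∀ i, ‖z i‖ ≤ r) → Φ t z ∉ cone s R → ∀ i, ‖Φ t z i‖ ≤ r

namespace HenonLike

variable {P : Type*} [TopologicalSpace P] {s : Fin 2} {R : ℝ} {D D' : ℕ} {Φ Ψ : P → C2 → C2}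

/-- Base case for products over lists; it is the reason why only `1 ≤ D` is required in the
structure. -/
lemma id : HenonLike s R 1 (fun _ : P => fun z => z) where
  one_le := le_rfl
  continuous := continuous_snd
  differentiable _ := differentiable_id
  mapsTo _ := mapsTo_id _
  expand _ _ _ := by simp
  lower := ⟨1, one_pos, fun _ _ _ => by simp⟩
  upper := ⟨1, le_rfl, fun _ _ => by simp⟩
  lipschitz := ⟨1, zero_le_one, fun _ _ _ => by simp⟩
  bounded _ _ _ _ h _ := h

/-- Invariance of the cone lets the estimates of the two maps be chained. Both must share the same
`s` and `R`. -/
lemma comp (hΨ : HenonLike s R D' Ψ) (hΦ : HenonLike s R D Φ) :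
    HenonLike s R (D' * D) (fun t z => Ψ t (Φ t z)) where
  one_le := Nat.mul_pos hΨ.one_le hΦ.one_le
  continuous := hΨ.continuous.comp (continuous_fst.prodMk hΦ.continuous)
  differentiable t := (hΨ.differentiable t).comp (hΦ.differentiable t)
  mapsTo t := (hΨ.mapsTo t).comp (hΦ.mapsTo t)
  expand t z hz := by
    have h1 := hΦ.expand t z hz
    have h2 := hΨ.expand t _ (hΦ.mapsTo t hz)
    push_cast
    rw [mul_assoc]
    exact (mul_le_mul_of_nonneg_left h1 (by positivity)).trans h2
  lower := by
    obtain ⟨c, hc, h1⟩ := hΦ.lower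
    obtain ⟨c', hc', h2⟩ := hΨ.lower
    refine ⟨c' * c ^ D', by positivity, fun t z hz => ?_⟩
    calc c' * c ^ D' * ‖z s‖ ^ (D' * D) = c' * (c * ‖z s‖ ^ D) ^ D' := by
          rw [mul_pow, ← pow_mul, mul_comm D D', mul_assoc]
      _ ≤ c' * ‖Φ t z s‖ ^ D' := by gcongr; exact h1 t z hz
      _ ≤ _ := h2 t _ (hΦ.mapsTo t hz)
  upper := by
    obtain ⟨C, hC, h1⟩ := hΦ.upper
    obtain ⟨C', hC', h2⟩ := hΨ.upper
    refine ⟨C' * C ^ D', one_le_mul_of_one_le_of_one_le hC' (one_le_pow₀ hC), fun t z => ?_⟩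
    calc max 1 ‖Ψ t (Φ t z)‖ ≤ C' * max 1 ‖Φ t z‖ ^ D' := h2 t _
      _ ≤ C' * (C * max 1 ‖z‖ ^ D) ^ D' := by gcongr; exact h1 t z
      _ = C' * C ^ D' * max 1 ‖z‖ ^ (D' * D) := by
          rw [mul_pow, ← pow_mul, mul_comm D D', mul_assoc]
  lipschitz := by
    obtain ⟨C, hC, h1⟩ := hΦ.upper
    obtain ⟨A, hA, h2⟩ := hΦ.lipschitz
    obtain ⟨B, hB, h3⟩ := hΨ.lipschitz
    refine ⟨B * C ^ (D' - 1) * A, by positivity, fun t z w => ?_⟩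
    set M := max 1 (max ‖z‖ ‖w‖) with hM
    have hM1 : 1 ≤ M := le_max_left _ _
    have hz : max 1 ‖z‖ ≤ M := max_le_max le_rfl (le_max_left _ _)
    have hw : max 1 ‖w‖ ≤ M := max_le_max le_rfl (le_max_right _ _)
    have hN : max 1 (max ‖Φ t z‖ ‖Φ t w‖) ≤ C * M ^ D := by
      have hz' : max 1 ‖Φ t z‖ ≤ C * M ^ D := (h1 t z).trans (by gcongr)
      have hw' : max 1 ‖Φ t w‖ ≤ C * M ^ D := (h1 t w).trans (by gcongr)
      exact max_le ((le_max_left _ _).trans hz')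
        (max_le ((le_max_right _ _).trans hz') ((le_max_right _ _).trans hw'))
    -- The outer map contributes `(M ^ D) ^ (D' - 1)` and the inner one `M ^ (D - 1)`.
    have hexp : D' * D - 1 = D * (D' - 1) + (D - 1) := by
      obtain ⟨k, rfl⟩ := Nat.exists_eq_add_of_le' hΦ.one_le
      obtain ⟨l, rfl⟩ := Nat.exists_eq_add_of_le' hΨ.one_le
      simp only [Nat.add_sub_cancel]
      rw [show (l + 1) * (k + 1) = (k + 1) * l + k + 1 by ring, Nat.add_sub_cancel]
    calc ‖Ψ t (Φ t z) - Ψ t (Φ t w)‖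
        ≤ B * max 1 (max ‖Φ t z‖ ‖Φ t w‖) ^ (D' - 1) * ‖Φ t z - Φ t w‖ := h3 t _ _
      _ ≤ B * (C * M ^ D) ^ (D' - 1) * (A * M ^ (D - 1) * ‖z - w‖) := by
          gcongr; exact h2 t z w
      _ = B * C ^ (D' - 1) * A * M ^ (D' * D - 1) * ‖z - w‖ := by
          rw [hexp, pow_add, pow_mul, mul_pow]; ring
  bounded t z r hr hz h := by
    refine hΨ.bounded t _ r hr (hΦ.bounded t z r hr hz fun h' => h (hΨ.mapsTo t h')) h

end HenonLike

/-! ### Random orbits and convergence to the rate of escape -/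

/-- The random orbit `Φ_{Λ (n-1)} ∘ ⋯ ∘ Φ_{Λ 0}`. -/
def orbit {P : Type*} (Φ : P → C2 → C2) (Λ : ℕ → P) : ℕ → C2 → C2
  | 0, z => z
  | n + 1, z => Φ (Λ n) (orbit Φ Λ n z)

/-- The `n`-th approximation of the rate of escape. -/
def escapeApprox {P : Type*} (Φ : P → C2 → C2) (D : ℕ) (Λ : ℕ → P) (n : ℕ) (z : C2) : ℝ :=
  1 / (D : ℝ) ^ n * Real.posLog ‖orbit Φ Λ n z‖

/-- The rate of escape. -/
def escapeRate {P : Type*} (Φ : P → C2 → C2) (D : ℕ) (Λ : ℕ → P) (z : C2) : ℝ :=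
  limUnder atTop fun n => escapeApprox Φ D Λ n z

namespace HenonLike

variable {P : Type*} [TopologicalSpace P] {s : Fin 2} {R : ℝ} {D : ℕ} {Φ : P → C2 → C2}

lemma orbit_mem_cone (h : HenonLike s R D Φ) {Λ : ℕ → P} {z : C2} {m n : ℕ} (hmn : m ≤ n)
    (hm : orbit Φ Λ m z ∈ cone s R) : orbit Φ Λ n z ∈ cone s R := by
  induction n, hmn using Nat.le_induction with
  | base => exact hm
  | succ n _ ih => exact h.mapsTo _ ih

/-- By invariance of the cone, an orbit outside it at time `n` was outside at every earlier time, so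
the field `bounded` applies at each step. -/
lemma orbit_bounded (h : HenonLike s R D Φ) {Λ : ℕ → P} {z : C2} {r : ℝ} (hr : R ≤ r)
    (hz : ∀ i, ‖z i‖ ≤ r) {n : ℕ} (hn : orbit Φ Λ n z ∉ cone s R) (i : Fin 2) :
    ‖orbit Φ Λ n z i‖ ≤ r := by
  induction n generalizing i with
  | zero => exact hz i
  | succ n ih =>
    exact h.bounded _ _ r hr (fun i => ih (fun h' => hn (h.mapsTo _ h')) i) hn i

lemma norm_orbit_le (h : HenonLike s R D Φ) {Λ : ℕ → P} {z : C2} {r : ℝ} (hr : R ≤ r)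
    (hz : ‖z‖ ≤ r) {n : ℕ} (hn : orbit Φ Λ n z ∉ cone s R) : ‖orbit Φ Λ n z‖ ≤ 2 * r :=
  norm_le_two_mul (h.orbit_bounded hr (fun i => (norm_apply_le_norm z i).trans hz) hn)

lemma continuous_orbit (h : HenonLike s R D Φ) (n : ℕ) :
    Continuous fun q : (ℕ → P) × C2 => orbit Φ q.1 n q.2 := by
  induction n with
  | zero => exact continuous_snd
  | succ n ih =>
    exact h.continuous.comp (((continuous_apply n).comp continuous_fst).prodMk ih)

lemma differentiable_orbit (h : HenonLike s R D Φ) (Λ : ℕ → P) (n : ℕ) :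
    Differentiable ℂ (orbit Φ Λ n) := by
  induction n with
  | zero => exact differentiable_id
  | succ n ih => exact (h.differentiable _).comp ih

lemma continuous_escapeApprox (h : HenonLike s R D Φ) (n : ℕ) :
    Continuous fun q : (ℕ → P) × C2 => escapeApprox Φ D q.1 n q.2 :=
  continuous_const.mul (Real.continuous_posLog.comp (h.continuous_orbit n).norm)

/-- Upper half of `log⁺ ‖Φ z‖ = D log⁺ ‖z‖ + O(1)`. It is global, whereas the lower half
`le_log_norm_map` is confined to the cone. -/
lemma posLog_norm_map_le (h : HenonLike s R D Φ) : ∃ B, 0 ≤ B ∧ ∀ t z,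
    Real.posLog ‖Φ t z‖ ≤ D * Real.posLog ‖z‖ + B := by
  obtain ⟨C, hC, h1⟩ := h.upper
  refine ⟨Real.log C, Real.log_nonneg hC, fun t z => ?_⟩
  rw [Real.posLog_eq_log_max_one (norm_nonneg _), Real.posLog_eq_log_max_one (norm_nonneg _)]
  have hz : 0 < max 1 ‖z‖ := by positivity
  refine (Real.log_le_log (by positivity) (h1 t z)).trans ?_
  rw [Real.log_mul (by positivity) (by positivity), Real.log_pow]
  linarith

lemma le_log_norm_map (h : HenonLike s R D Φ) (hR : 1 ≤ R) : ∃ B, 0 ≤ B ∧ ∀ t, ∀ z ∈ cone s R,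
    D * Real.log ‖z s‖ - B ≤ Real.log ‖Φ t z s‖ := by
  obtain ⟨c, hc, h1⟩ := h.lower
  refine ⟨|Real.log c|, abs_nonneg _, fun t z hz => ?_⟩
  have hz0 : 0 < ‖z s‖ := by linarith [hz.1]
  have := Real.log_le_log (by positivity) (h1 t z hz)
  rw [Real.log_mul (by positivity) (by positivity), Real.log_pow] at this
  linarith [neg_abs_le (Real.log c)]

/-- At bounded cost, `log⁺` of the norm becomes the logarithm of one coordinate, which is harmonic
along holomorphic discs. -/
lemma posLog_norm_sub_log (hR : 1 ≤ R) {z : C2} (hz : z ∈ cone s R) :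
    Real.log ‖z s‖ ≤ Real.posLog ‖z‖ ∧ Real.posLog ‖z‖ ≤ Real.log ‖z s‖ + Real.log 2 := by
  have h1 : 1 ≤ ‖z s‖ := hR.trans hz.1
  have h2 : ‖z s‖ ≤ ‖z‖ := norm_apply_le_norm z s
  have h3 : ‖z‖ ≤ 2 * ‖z s‖ := norm_le_two_mul hz.2
  rw [Real.posLog_eq_log (by simpa using h1.trans h2)]
  refine ⟨Real.log_le_log (by linarith) h2, ?_⟩
  rw [add_comm, ← Real.log_mul two_ne_zero (by linarith)]
  exact Real.log_le_log (by linarith) h3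

/-- The approximations of the rate of escape converge at a geometric rate, locally uniformly. -/
lemma dist_escapeApprox_le (h : HenonLike s R D Φ) (hR : 1 ≤ R) (ρ : ℝ) :
    ∃ C, 0 ≤ C ∧ ∀ (Λ : ℕ → P) (z : C2), ‖z‖ ≤ ρ → ∀ n,
      dist (escapeApprox Φ D Λ n z) (escapeApprox Φ D Λ (n + 1) z) ≤ C / (D : ℝ) ^ n := by
  obtain ⟨B, hB, h1⟩ := h.posLog_norm_map_le
  obtain ⟨A, hA, h2⟩ := h.le_log_norm_map hR
  have hD : (1 : ℝ) ≤ D := by exact_mod_cast h.one_le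
  set r := max R ρ with hr
  have hr1 : 1 ≤ r := hR.trans (le_max_left _ _)
  have hlog2 : 0 ≤ Real.log 2 := Real.log_nonneg one_le_two
  have hlogr : 0 ≤ Real.posLog (2 * r) := Real.posLog_nonneg
  refine ⟨B + A + D * Real.log 2 + D * Real.posLog (2 * r), by positivity, fun Λ z hz n => ?_⟩
  set a := Real.posLog ‖orbit Φ Λ n z‖ with ha
  set b := Real.posLog ‖orbit Φ Λ (n + 1) z‖ with hb
  have hD0 : (0 : ℝ) < D := by linarith
  have hab1 : b ≤ D * a + B := h1 _ _
  have hab2 : D * a - (A + D * Real.log 2 + D * Real.posLog (2 * r)) ≤ b := by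
    by_cases hc : orbit Φ Λ n z ∈ cone s R
    · have h3 := (posLog_norm_sub_log hR hc).2
      have h4 := (posLog_norm_sub_log hR (h.mapsTo (Λ n) hc)).1
      have h5 := h2 (Λ n) _ hc
      have h6 := mul_le_mul_of_nonneg_left h3 hD0.le
      have h7 : 0 ≤ D * Real.posLog (2 * r) := by positivity
      change _ ≤ Real.posLog ‖Φ (Λ n) (orbit Φ Λ n z)‖
      linarith
    -- Outside the cone the orbit has not left the ball of radius `2 * r`, so `D * a` is itself
    -- bounded and `0 ≤ b` suffices.
    · have h3 := h.norm_orbit_le (le_max_left R ρ) (hz.trans (le_max_right R ρ)) hc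
      have h4 : a ≤ Real.posLog (2 * r) := Real.posLog_le_posLog (norm_nonneg _) h3
      have h5 := mul_le_mul_of_nonneg_left h4 hD0.le
      have h6 : 0 ≤ D * Real.log 2 := by positivity
      have h7 : 0 ≤ b := Real.posLog_nonneg
      linarith
  have hE : 0 ≤ D * Real.log 2 + D * Real.posLog (2 * r) := by positivity
  have habs : |D * a - b| ≤ B + A + D * Real.log 2 + D * Real.posLog (2 * r) := by
    rw [abs_le]; constructor <;> linarith
  have hid : escapeApprox Φ D Λ n z - escapeApprox Φ D Λ (n + 1) z
      = (D * a - b) / (D : ℝ) ^ (n + 1) := by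
    simp only [escapeApprox, ← ha, ← hb]
    field_simp
    ring
  rw [Real.dist_eq, hid, abs_div, abs_of_pos (by positivity : (0 : ℝ) < (D : ℝ) ^ (n + 1))]
  gcongr
  exact n.le_succ

lemma exists_escapeApprox_bound (h : HenonLike s R D Φ) (hR : 1 ≤ R) (hD : 2 ≤ D) (ρ : ℝ) :
    ∃ C, 0 ≤ C ∧ ∀ (Λ : ℕ → P) (z : C2), ‖z‖ ≤ ρ →
      Tendsto (fun n => escapeApprox Φ D Λ n z) atTop (𝓝 (escapeRate Φ D Λ z)) ∧
      ∀ n, |escapeApprox Φ D Λ n z - escapeRate Φ D Λ z| ≤ C / (D : ℝ) ^ n := by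
  obtain ⟨C, hC, h1⟩ := h.dist_escapeApprox_le hR ρ
  have hD' : (2 : ℝ) ≤ D := by exact_mod_cast hD
  have hr : (D : ℝ)⁻¹ < 1 := inv_lt_one_of_one_lt₀ (by linarith)
  refine ⟨C / (1 - (D : ℝ)⁻¹), div_nonneg hC (by linarith), fun Λ z hz => ?_⟩
  have h2 : ∀ n, dist (escapeApprox Φ D Λ n z) (escapeApprox Φ D Λ (n + 1) z)
      ≤ C * (D : ℝ)⁻¹ ^ n := fun n => by
    simpa [div_eq_mul_inv] using h1 Λ z hz n
  have h3 : Tendsto (fun n => escapeApprox Φ D Λ n z) atTop (𝓝 (escapeRate Φ D Λ z)) :=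
    (cauchySeq_of_le_geometric _ C hr h2).tendsto_limUnder
  refine ⟨h3, fun n => ?_⟩
  have h4 := dist_le_of_le_geometric_of_tendsto _ C hr h2 h3 n
  rw [Real.dist_eq] at h4
  refine h4.trans (le_of_eq ?_)
  rw [inv_pow]
  ring

lemma tendsto_escapeApprox (h : HenonLike s R D Φ) (hR : 1 ≤ R) (hD : 2 ≤ D) (Λ : ℕ → P) (z : C2) :
    Tendsto (fun n => escapeApprox Φ D Λ n z) atTop (𝓝 (escapeRate Φ D Λ z)) := by
  obtain ⟨C, _, h1⟩ := h.exists_escapeApprox_bound hR hD ‖z‖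
  exact (h1 Λ z le_rfl).1

lemma escapeRate_nonneg (h : HenonLike s R D Φ) (hR : 1 ≤ R) (hD : 2 ≤ D) (Λ : ℕ → P) (z : C2) :
    0 ≤ escapeRate Φ D Λ z :=
  ge_of_tendsto' (h.tendsto_escapeApprox hR hD Λ z) fun n =>
    mul_nonneg (by positivity) Real.posLog_nonneg

/-- The geometric convergence is uniform over all `Λ` and over `z` in a ball, so the limit inherits
joint continuity. -/
lemma continuous_escapeRate (h : HenonLike s R D Φ) (hR : 1 ≤ R) (hD : 2 ≤ D) :
    Continuous fun q : (ℕ → P) × C2 => escapeRate Φ D q.1 q.2 := by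
  have hD' : (1 : ℝ) < D := by exact_mod_cast (by omega : 1 < D)
  refine continuous_iff_continuousAt.2 fun q₀ => ?_
  obtain ⟨C, hC, h1⟩ := h.exists_escapeApprox_bound hR hD (‖q₀.2‖ + 1)
  set U : Set ((ℕ → P) × C2) := univ ×ˢ ball q₀.2 1
  have hU : U ∈ 𝓝 q₀ := prod_mem_nhds univ_mem (ball_mem_nhds _ one_pos)
  have hlim : TendstoUniformlyOn (fun n (q : (ℕ → P) × C2) => escapeApprox Φ D q.1 n q.2)
      (fun q => escapeRate Φ D q.1 q.2) atTop U := by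
    rw [Metric.tendstoUniformlyOn_iff]
    intro ε hε
    have ht : Tendsto (fun n : ℕ => C / (D : ℝ) ^ n) atTop (𝓝 0) :=
      tendsto_const_nhds.div_atTop (tendsto_pow_atTop_atTop_of_one_lt hD')
    filter_upwards [ht.eventually_lt_const hε] with n hn q hq
    rw [dist_comm, Real.dist_eq]
    refine ((h1 q.1 q.2 ?_).2 n).trans_lt hn
    have h2 : ‖q.2 - q₀.2‖ < 1 := by simpa [U, dist_eq_norm] using hq
    have h3 := norm_add_le (q.2 - q₀.2) q₀.2
    rw [sub_add_cancel] at h3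
    linarith
  exact (hlim.continuousOn (Frequently.of_forall fun n =>
    (h.continuous_escapeApprox n).continuousOn)).continuousAt hU

lemma continuous_escapeRate_comp (h : HenonLike s R D Φ) (hR : 1 ≤ R) (hD : 2 ≤ D) {X : Type*}
    [TopologicalSpace X] {f : X → ℕ → P} {g : X → C2} (hf : Continuous f) (hg : Continuous g) :
    Continuous fun x => escapeRate Φ D (f x) (g x) := by
  have := (h.continuous_escapeRate hR hD).comp (hf.prodMk hg)
  exact this

/-- The rate of escape is locally bounded, uniformly in the parameters. -/
lemma exists_escapeRate_le (h : HenonLike s R D Φ) (hR : 1 ≤ R) (hD : 2 ≤ D) (ρ : ℝ) :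
    ∃ C, ∀ (Λ : ℕ → P) (z : C2), ‖z‖ ≤ ρ → |escapeRate Φ D Λ z| ≤ C ∧
      ∀ n, |escapeApprox Φ D Λ n z| ≤ C := by
  obtain ⟨C, hC, h1⟩ := h.exists_escapeApprox_bound hR hD ρ
  have hD' : (1 : ℝ) ≤ D := by exact_mod_cast (by omega : 1 ≤ D)
  -- The zeroth approximation is `log⁺ ‖z‖`; one `C` leads from it to the limit, the other from the
  -- limit to the `n`-th approximation.
  refine ⟨Real.posLog ρ + C + C, fun Λ z hz => ?_⟩
  have h2 := (h1 Λ z hz).2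
  have h3 := abs_le.1 (h2 0)
  have h4 : escapeApprox Φ D Λ 0 z ≤ Real.posLog ρ := by
    simpa [escapeApprox, orbit] using Real.posLog_le_posLog (norm_nonneg z) hz
  have h5 : 0 ≤ escapeApprox Φ D Λ 0 z := mul_nonneg (by positivity) Real.posLog_nonneg
  have h6 : escapeRate Φ D Λ z ≤ Real.posLog ρ + C := by
    simp only [pow_zero, div_one] at h3
    linarith
  have h7 := h.escapeRate_nonneg hR hD Λ z
  refine ⟨by rw [abs_of_nonneg h7]; linarith, fun n => ?_⟩
  have h8 : C / (D : ℝ) ^ n ≤ C := div_le_self hC (one_le_pow₀ hD')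
  have h9 := abs_le.1 ((h2 n).trans h8)
  have h10 : 0 ≤ escapeApprox Φ D Λ n z := mul_nonneg (by positivity) Real.posLog_nonneg
  rw [abs_of_nonneg h10]
  linarith

end HenonLike

/-! ### Escaping versus bounded orbits; mean value properties of the rate of escape -/

namespace HenonLike

variable {P : Type*} [TopologicalSpace P] {s : Fin 2} {R : ℝ} {D : ℕ} {Φ : P → C2 → C2}

lemma two_pow_le_norm_orbit (h : HenonLike s R D Φ) (hR : 1 ≤ R) (hD : 2 ≤ D) {Λ : ℕ → P} {z : C2}
    {N : ℕ} (hN : orbit Φ Λ N z ∈ cone s R) (k : ℕ) : 2 ^ k ≤ ‖orbit Φ Λ (N + k) z s‖ := by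
  have hD' : (2 : ℝ) ≤ D := by exact_mod_cast hD
  induction k with
  | zero => simpa using hR.trans hN.1
  | succ k ih =>
    refine le_trans ?_ (h.expand (Λ (N + k)) _ (h.orbit_mem_cone (Nat.le_add_right N k) hN))
    rw [pow_succ']
    exact mul_le_mul hD' ih (by positivity) (by positivity)

lemma exists_le_norm_orbit (h : HenonLike s R D Φ) (hR : 1 ≤ R) (hD : 2 ≤ D) {Λ : ℕ → P} {z : C2}
    {N : ℕ} (hN : orbit Φ Λ N z ∈ cone s R) (r : ℝ) : ∃ n ≥ N, r < ‖orbit Φ Λ n z s‖ := by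
  obtain ⟨k, hk⟩ := pow_unbounded_of_one_lt r one_lt_two
  exact ⟨N + k, Nat.le_add_right _ _, hk.trans_le (h.two_pow_le_norm_orbit hR hD hN k)⟩

/-- In the cone the dominant coordinate at least doubles at each step beyond its initial bound,
while an orbit that never enters it is trapped in a box. -/
lemma isBounded_orbit_iff (h : HenonLike s R D Φ) (hR : 1 ≤ R) (hD : 2 ≤ D) {Λ : ℕ → P} {z : C2} :
    Bornology.IsBounded (range fun n => orbit Φ Λ n z) ↔ ∀ n, orbit Φ Λ n z ∉ cone s R := by
  constructor
  · intro hb n hn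
    obtain ⟨C, hC⟩ := hb.exists_norm_le
    obtain ⟨m, _, hm⟩ := h.exists_le_norm_orbit hR hD hn C
    have := hC _ ⟨m, rfl⟩
    have := norm_apply_le_norm (orbit Φ Λ m z) s
    linarith
  · intro hn
    refine isBounded_iff_forall_norm_le.2 ⟨2 * max R ‖z‖, ?_⟩
    rintro _ ⟨n, rfl⟩
    exact h.norm_orbit_le (le_max_left _ _) (le_max_right _ _) (hn n)

lemma escapeRate_eq_zero (h : HenonLike s R D Φ) (hR : 1 ≤ R) (hD : 2 ≤ D) {Λ : ℕ → P} {z : C2}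
    (hz : ∀ n, orbit Φ Λ n z ∉ cone s R) : escapeRate Φ D Λ z = 0 := by
  have hD' : (1 : ℝ) < D := by exact_mod_cast (by omega : 1 < D)
  refine tendsto_nhds_unique (h.tendsto_escapeApprox hR hD Λ z) ?_
  refine squeeze_zero (g := fun n => Real.posLog (2 * max R ‖z‖) / (D : ℝ) ^ n)
    (fun n => mul_nonneg (by positivity) Real.posLog_nonneg) (fun n => ?_)
    (tendsto_const_nhds.div_atTop (tendsto_pow_atTop_atTop_of_one_lt hD'))
  rw [escapeApprox, one_div, inv_mul_eq_div]
  exact div_le_div_of_nonneg_right (Real.posLog_le_posLog (norm_nonneg _)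
    (h.norm_orbit_le (le_max_left _ _) (le_max_right _ _) (hz n))) (by positivity)

lemma escapeRate_pos (h : HenonLike s R D Φ) (hR : 1 ≤ R) (hD : 2 ≤ D) {Λ : ℕ → P} {z : C2}
    {N : ℕ} (hN : orbit Φ Λ N z ∈ cone s R) : 0 < escapeRate Φ D Λ z := by
  have hD' : (2 : ℝ) ≤ D := by exact_mod_cast hD
  obtain ⟨B, hB, h1⟩ := h.le_log_norm_map hR
  -- From this threshold on, the additive loss `B` is absorbed: `D * (D ^ k + B) - 2 * B ≥ D ^ (k +
  -- 1)` because `2 ≤ D`.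
  obtain ⟨m, hm, hm'⟩ := h.exists_le_norm_orbit hR hD hN (Real.exp (B + 1))
  have h2 : ∀ k, (D : ℝ) ^ k ≤ Real.log ‖orbit Φ Λ (m + k) z s‖ - B := by
    intro k
    induction k with
    | zero =>
      have := Real.log_le_log (Real.exp_pos _) hm'.le
      rw [Real.log_exp] at this
      simpa using by linarith
    | succ k ih =>
      have h3 := h1 (Λ (m + k)) _ (h.orbit_mem_cone (by omega) hN : orbit Φ Λ (m + k) z ∈ cone s R)
      have h4 := mul_le_mul_of_nonneg_left ih (by linarith : (0 : ℝ) ≤ D)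
      rw [pow_succ']
      change _ ≤ Real.log ‖Φ (Λ (m + k)) (orbit Φ Λ (m + k) z) s‖ - B
      nlinarith
  refine lt_of_lt_of_le (by positivity : 0 < 1 / (D : ℝ) ^ m)
    (ge_of_tendsto (h.tendsto_escapeApprox hR hD Λ z) ?_)
  filter_upwards [eventually_ge_atTop m] with n hn
  obtain ⟨k, rfl⟩ := Nat.exists_eq_add_of_le hn
  have h3 := (posLog_norm_sub_log hR (h.orbit_mem_cone (by omega) hN :
    orbit Φ Λ (m + k) z ∈ cone s R)).1
  have h4 := h2 k
  calc 1 / (D : ℝ) ^ m = 1 / (D : ℝ) ^ (m + k) * (D : ℝ) ^ k := by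
        rw [pow_add]; field_simp
    _ ≤ _ := by
      unfold escapeApprox
      gcongr
      linarith

/-- On a compact set of escaping points, the cone is reached after a bounded time. -/
lemma exists_forall_orbit_mem_cone (h : HenonLike s R D Φ) (hR : 1 ≤ R) (hD : 2 ≤ D) (Λ : ℕ → P)
    {S : Set C2} (hS : IsCompact S) (hesc : ∀ z ∈ S, ∃ n, orbit Φ Λ n z ∈ cone s R) :
    ∃ N, ∀ z ∈ S, ∀ n ≥ N, orbit Φ Λ n z ∈ cone s R := by
  obtain ⟨ρ, hρ⟩ := hS.isBounded.exists_norm_le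
  set r := max R ρ with hr
  -- The cone is not open, so the covering uses the open condition `r < ‖z s‖`, which forces orbits
  -- from `S` into the cone.
  have hcone : ∀ z ∈ S, ∀ n, r < ‖orbit Φ Λ n z s‖ → orbit Φ Λ n z ∈ cone s R := by
    intro z hz n hn
    by_contra hc
    have := h.orbit_bounded (le_max_left R ρ)
      (fun i => (norm_apply_le_norm z i).trans ((hρ z hz).trans (le_max_right R ρ))) hc s
    linarith
  obtain ⟨F, hF⟩ := hS.elim_finite_subcover (fun n => {z | r < ‖orbit Φ Λ n z s‖})
    (fun n => isOpen_lt continuous_const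
      ((PiLp.continuous_apply 2 _ s).comp (h.differentiable_orbit Λ n).continuous).norm)
    (fun z hz => by
      obtain ⟨m, hm⟩ := hesc z hz
      obtain ⟨n, _, hn⟩ := h.exists_le_norm_orbit hR hD hm r
      exact mem_iUnion.2 ⟨n, hn⟩)
  refine ⟨F.sup _root_.id, fun z hz n hn => ?_⟩
  obtain ⟨m, hm⟩ := mem_iUnion.1 (hF hz)
  obtain ⟨hmF, hm⟩ := mem_iUnion.1 hm
  exact h.orbit_mem_cone ((Finset.le_sup (f := _root_.id) hmF).trans hn) (hcone z hz m hm)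

lemma norm_affine_le {a b : C2} {ζ : ℂ} (hζ : ζ ∈ closedBall (0 : ℂ) 1) :
    ‖a + ζ • b‖ ≤ ‖a‖ + ‖b‖ := by
  have h1 : ‖ζ‖ ≤ 1 := by simpa using hζ
  refine (norm_add_le _ _).trans ?_
  rw [norm_smul]
  nlinarith [norm_nonneg b]

/-- The Poisson formula for the rate of escape on a complex disc of escaping points. -/
lemma circleAverage_escapeRate (h : HenonLike s R D Φ) (hR : 1 ≤ R) (hD : 2 ≤ D) (Λ : ℕ → P)
    {a b : C2} (hesc : ∀ ζ ∈ closedBall (0 : ℂ) 1, ∃ n, orbit Φ Λ n (a + ζ • b) ∈ cone s R)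
    {w : ℂ} (hw : w ∈ ball (0 : ℂ) 1) :
    Real.circleAverage ((Complex.re ∘ herglotzRieszKernel 0 w) •
      fun ζ : ℂ => escapeRate Φ D Λ (a + ζ • b)) 0 1 = escapeRate Φ D Λ (a + w • b) := by
  have hD' : (1 : ℝ) < D := by exact_mod_cast (by omega : 1 < D)
  set κ : ℂ → ℝ := Complex.re ∘ herglotzRieszKernel 0 w with hκ
  have hκc : ContinuousOn κ (sphere 0 1) := continuousOn_re_herglotzRieszKernel hw
  set line : ℂ → C2 := fun ζ => a + ζ • b with hline
  have hlined : Differentiable ℂ line := by fun_prop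
  obtain ⟨N, hN⟩ := h.exists_forall_orbit_mem_cone hR hD Λ
    ((isCompact_closedBall (0 : ℂ) 1).image hlined.continuous) (by
      rintro _ ⟨ζ, hζ, rfl⟩
      exact hesc ζ hζ)
  set f : ℕ → ℂ → ℂ := fun n ζ => orbit Φ Λ (N + n) (line ζ) s with hf
  have hfd : ∀ n, Differentiable ℂ (f n) := fun n =>
    (EuclideanSpace.proj (𝕜 := ℂ) s).differentiable.comp
      ((h.differentiable_orbit Λ (N + n)).comp hlined)
  have hfc : ∀ n, ∀ ζ ∈ closedBall (0 : ℂ) 1, orbit Φ Λ (N + n) (line ζ) ∈ cone s R :=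
    fun n ζ hζ => hN _ ⟨ζ, hζ, rfl⟩ _ (Nat.le_add_right N n)
  have hf1 : ∀ n, ∀ ζ ∈ closedBall (0 : ℂ) 1, 1 ≤ ‖f n ζ‖ := fun n ζ hζ => hR.trans (hfc n ζ hζ).1
  have hf0 : ∀ n, ∀ ζ ∈ closedBall (0 : ℂ) 1, f n ζ ≠ 0 := fun n ζ hζ =>
    norm_pos_iff.1 (by linarith [hf1 n ζ hζ])
  -- Harmonic on the closed disc because `f n` has no zeros there, and within `log 2 / D ^ (N + n)`
  -- of the approximation of the rate of escape.
  set v : ℕ → ℂ → ℝ := fun n => (1 / (D : ℝ) ^ (N + n)) • fun ζ => Real.log ‖f n ζ‖ with hv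
  have hvh : ∀ n, HarmonicOnNhd (v n) (closedBall 0 1) := fun n ζ hζ =>
    (((hfd n).analyticAt ζ).harmonicAt_log_norm (hf0 n ζ hζ)).const_smul
  have hclose : ∀ n, ∀ ζ ∈ closedBall (0 : ℂ) 1,
      v n ζ ≤ escapeApprox Φ D Λ (N + n) (line ζ) ∧
      escapeApprox Φ D Λ (N + n) (line ζ) ≤ v n ζ + Real.log 2 / (D : ℝ) ^ (N + n) := by
    intro n ζ hζ
    have h1 := posLog_norm_sub_log hR (hfc n ζ hζ)
    have h2 : 0 ≤ 1 / (D : ℝ) ^ (N + n) := by positivity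
    have h3 := mul_le_mul_of_nonneg_left h1.1 h2
    have h4 := mul_le_mul_of_nonneg_left h1.2 h2
    simp only [hv, Pi.smul_apply, smul_eq_mul, escapeApprox]
    refine ⟨h3, h4.trans (le_of_eq ?_)⟩
    rw [hf]; ring
  have hlim : ∀ ζ ∈ closedBall (0 : ℂ) 1,
      Tendsto (fun n => v n ζ) atTop (𝓝 (escapeRate Φ D Λ (line ζ))) := by
    intro ζ hζ
    have h1 : Tendsto (fun n => escapeApprox Φ D Λ (N + n) (line ζ)) atTop
        (𝓝 (escapeRate Φ D Λ (line ζ))) :=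
      (h.tendsto_escapeApprox hR hD Λ (line ζ)).comp
        (tendsto_atTop_mono (fun n => Nat.le_add_left n N) tendsto_id)
    have h2 : Tendsto (fun n : ℕ => Real.log 2 / (D : ℝ) ^ (N + n)) atTop (𝓝 0) :=
      tendsto_const_nhds.div_atTop ((tendsto_pow_atTop_atTop_of_one_lt hD').comp
        (tendsto_atTop_mono (fun n => Nat.le_add_left n N) tendsto_id))
    refine tendsto_of_tendsto_of_tendsto_of_le_of_le (by simpa using h1.sub h2) h1
      (fun n => ?_) (fun n => (hclose n ζ hζ).1)
    have := (hclose n ζ hζ).2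
    simp only
    linarith
  obtain ⟨C, hC⟩ := h.exists_escapeRate_le hR hD (‖a‖ + ‖b‖)
  obtain ⟨K, hK⟩ := ((isCompact_sphere (0 : ℂ) 1).image_of_continuousOn hκc).isBounded.exists_norm_le
  have hlimavg := tendsto_circleAverage (f := fun n => κ • v n)
    (g := κ • fun ζ => escapeRate Φ D Λ (line ζ)) (K * C)
    (fun n => hκc.mul (((hvh n).continuousOn).mono sphere_subset_closedBall))
    (fun n ζ hζ => by
      have hζ' := sphere_subset_closedBall hζ
      have h0 : 0 ≤ v n ζ := by
        simp only [hv, Pi.smul_apply, smul_eq_mul]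
        exact mul_nonneg (by positivity) (Real.log_nonneg (hf1 n ζ hζ'))
      have h1 := (hC Λ (line ζ) (norm_affine_le hζ')).2 (N + n)
      have h2 := (hclose n ζ hζ').1
      have h3 := hK _ ⟨ζ, hζ, rfl⟩
      rw [Pi.smul_apply', smul_eq_mul, abs_mul]
      refine mul_le_mul h3 ?_ (abs_nonneg _) ((norm_nonneg _).trans h3)
      rw [abs_of_nonneg h0]
      exact h2.trans ((le_abs_self _).trans h1))
    (fun ζ hζ => (hlim ζ (sphere_subset_closedBall hζ)).const_mul (κ ζ))
  refine tendsto_nhds_unique hlimavg ?_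
  refine (hlim w (ball_subset_closedBall hw)).congr fun n => ?_
  exact ((hvh n).circleAverage_re_herglotzRieszKernel_smul hw).symm

/-- The sub-mean value inequality for the rate of escape. -/
lemma escapeRate_le_circleAverage (h : HenonLike s R D Φ) (hR : 1 ≤ R) (hD : 2 ≤ D) (Λ : ℕ → P)
    (a b : C2) :
    escapeRate Φ D Λ a ≤ Real.circleAverage (fun ζ : ℂ => escapeRate Φ D Λ (a + ζ • b)) 0 1 := by
  obtain ⟨C, hC⟩ := h.exists_escapeRate_le hR hD (‖a‖ + ‖b‖)
  have hlimavg := tendsto_circleAverage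
    (f := fun n (ζ : ℂ) => escapeApprox Φ D Λ n (a + ζ • b))
    (g := fun ζ => escapeRate Φ D Λ (a + ζ • b)) C
    (fun n => ((h.continuous_escapeApprox n).comp (by fun_prop :
      Continuous fun ζ : ℂ => (Λ, a + ζ • b))).continuousOn)
    (fun n ζ hζ => (hC Λ _ (norm_affine_le (sphere_subset_closedBall hζ))).2 n)
    (fun ζ _ => h.tendsto_escapeApprox hR hD Λ _)
  refine le_of_tendsto_of_tendsto' (h.tendsto_escapeApprox hR hD Λ a) hlimavg fun n => ?_
  have h1 := posLog_norm_le_circleAverage (f := fun ζ : ℂ => orbit Φ Λ n (a + ζ • b))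
    ((h.differentiable_orbit Λ n).comp (by fun_prop))
  have h2 := mul_le_mul_of_nonneg_left h1 (by positivity : 0 ≤ 1 / (D : ℝ) ^ n)
  simp only [zero_smul, add_zero] at h2
  refine h2.trans (le_of_eq ?_)
  rw [← smul_eq_mul, ← Real.circleAverage_fun_smul]
  rfl

/-! ### Hölder estimates -/

/-- Exponential growth of the distance of two orbits, relative to their size. -/
lemma norm_orbit_sub_le (h : HenonLike s R D Φ) (hR : 1 ≤ R) (ρ : ℝ) :
    ∃ L, (D : ℝ) ≤ L ∧ ∀ (Λ : ℕ → P) (z w : C2), ‖z‖ ≤ ρ → ‖w‖ ≤ ρ → ∀ n,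
      ‖orbit Φ Λ n z - orbit Φ Λ n w‖ ≤
        L ^ n * ‖z - w‖ * max 1 (max ‖orbit Φ Λ n z‖ ‖orbit Φ Λ n w‖) := by
  obtain ⟨A, hA, h1⟩ := h.lipschitz
  obtain ⟨c, hc, h2⟩ := h.lower
  set r := max R ρ with hr
  have hr1 : 1 ≤ r := hR.trans (le_max_left _ _)
  set c' := min (c / 2 ^ D) (1 / (2 * r) ^ D) with hc'
  -- The first entry of `c'` serves in the cone, where `‖x‖ ≤ 2 * ‖x s‖`; the second serves outside,
  -- where the orbit has norm at most `2 * r`.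
  have hc'0 : 0 < c' := lt_min (by positivity) (by positivity)
  have hgrow1 : ∀ (Λ : ℕ → P) (z : C2), ‖z‖ ≤ ρ → ∀ n,
      c' * max 1 ‖orbit Φ Λ n z‖ ^ D ≤ max 1 ‖orbit Φ Λ (n + 1) z‖ := by
    intro Λ z hz n
    by_cases hcn : orbit Φ Λ n z ∈ cone s R
    · set x := orbit Φ Λ n z
      have hx1 : 1 ≤ ‖x s‖ := hR.trans hcn.1
      have hx2 : max 1 ‖x‖ ≤ 2 * ‖x s‖ := max_le (by linarith) (norm_le_two_mul hcn.2)
      calc c' * max 1 ‖x‖ ^ D ≤ c / 2 ^ D * (2 * ‖x s‖) ^ D := by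
            gcongr; exact min_le_left _ _
        _ = c * ‖x s‖ ^ D := by rw [mul_pow]; field_simp
        _ ≤ ‖Φ (Λ n) x s‖ := h2 _ _ hcn
        _ ≤ ‖Φ (Λ n) x‖ := norm_apply_le_norm _ _
        _ ≤ _ := le_max_right _ _
    · have hx := h.norm_orbit_le (le_max_left R ρ) (hz.trans (le_max_right R ρ)) hcn
      calc c' * max 1 ‖orbit Φ Λ n z‖ ^ D ≤ 1 / (2 * r) ^ D * (2 * r) ^ D := by
            gcongr
            · exact min_le_right _ _
            · exact max_le (by linarith) hx
        _ = 1 := by field_simp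
        _ ≤ _ := le_max_left _ _
  -- With `A ≤ L * c'`, the factor `M ^ D` produced by one step is absorbed by the growth of the
  -- larger orbit. The bound `D ≤ L` keeps the Hölder exponent at most one.
  refine ⟨max D (A / c'), le_max_left _ _, fun Λ z w hz hw n => ?_⟩
  set L := max (D : ℝ) (A / c') with hL
  have hL0 : 0 ≤ L := le_trans (by positivity) (le_max_left _ _)
  have hAL : A ≤ L * c' := (div_le_iff₀ hc'0).1 (le_max_right _ _)
  induction n with
  | zero =>
    simp only [orbit, pow_zero, one_mul]
    exact le_mul_of_one_le_right (norm_nonneg _) (le_max_left _ _)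
  | succ n ih =>
    set x := orbit Φ Λ n z
    set y := orbit Φ Λ n w
    set M := max 1 (max ‖x‖ ‖y‖) with hM
    have hM1 : 1 ≤ M := le_max_left _ _
    have hgrow : c' * M ^ D ≤ max 1 (max ‖Φ (Λ n) x‖ ‖Φ (Λ n) y‖) := by
      rcases le_total ‖x‖ ‖y‖ with hxy | hxy
      · rw [hM, max_eq_right hxy]
        exact (hgrow1 Λ w hw n).trans (max_le_max le_rfl (le_max_right _ _))
      · rw [hM, max_eq_left hxy]
        exact (hgrow1 Λ z hz n).trans (max_le_max le_rfl (le_max_left _ _))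
    calc ‖Φ (Λ n) x - Φ (Λ n) y‖ ≤ A * M ^ (D - 1) * ‖x - y‖ := h1 _ _ _
      _ ≤ A * M ^ (D - 1) * (L ^ n * ‖z - w‖ * M) := by gcongr
      _ = A * (L ^ n * ‖z - w‖ * M ^ D) := by
          rw [← Nat.sub_add_cancel h.one_le, pow_succ, Nat.add_sub_cancel]; ring
      _ ≤ L * c' * (L ^ n * ‖z - w‖ * M ^ D) := by gcongr
      _ = L ^ (n + 1) * ‖z - w‖ * (c' * M ^ D) := by ring
      _ ≤ _ := mul_le_mul_of_nonneg_left hgrow (by positivity)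

end HenonLike

/-- For `a = max 1 x ≥ b = max 1 y`, the relative error `e ≤ 1 / 2` gives `b ≥ a / 2`, so `log (a /
b) ≤ a / b - 1 ≤ 2 * e`. -/
lemma posLog_sub_posLog_le {x y e : ℝ} (hx : 0 ≤ x) (hy : 0 ≤ y)
    (hxy : |x - y| ≤ e * max 1 (max x y)) (he : e ≤ 1 / 2) :
    |Real.posLog x - Real.posLog y| ≤ 2 * e := by
  wlog hle : y ≤ x generalizing x y
  · rw [abs_sub_comm]
    exact this hy hx (by rwa [abs_sub_comm, max_comm y x]) (le_of_not_ge hle)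
  rw [abs_of_nonneg (sub_nonneg.2 (Real.posLog_le_posLog hy hle)),
    Real.posLog_eq_log_max_one hx, Real.posLog_eq_log_max_one hy]
  rw [max_eq_left hle, abs_of_nonneg (by linarith)] at hxy
  have ha : 1 ≤ max 1 x := le_max_left _ _
  have hb : 1 ≤ max 1 y := le_max_left _ _
  have hab : max 1 x - max 1 y ≤ e * max 1 x := by
    rcases le_total x 1 with h1 | h1
    · have := le_max_left 1 y
      rw [max_eq_left h1] at hxy ⊢
      linarith
    · rw [max_eq_right h1] at hxy ⊢
      linarith [le_max_right 1 y]
  have he0 : 0 ≤ e := by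
    have : 0 ≤ e * max 1 x := by linarith
    exact nonneg_of_mul_nonneg_left this (by linarith)
  rw [← Real.log_div (by positivity) (by positivity)]
  refine (Real.log_le_sub_one_of_pos (by positivity)).trans ?_
  rw [div_sub_one (by positivity), div_le_iff₀ (by positivity)]
  nlinarith

/-- Hölder estimates from a competition of exponential rates. -/
lemma le_rpow_of_forall_pow_le {D L C δ x : ℝ} (hD : 1 < D) (hL : D ≤ L) (hC : 0 ≤ C)
    (hδ : 0 < δ) (hδ' : δ ≤ 1 / 2) (h : ∀ n : ℕ, L ^ n * δ ≤ 1 / 2 → x ≤ C / D ^ n) :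
    x ≤ C * (2 * L) ^ (Real.log D / Real.log L) * δ ^ (Real.log D / Real.log L) := by
  have hL1 : 1 < L := hD.trans_le hL
  have hlD : 0 < Real.log D := Real.log_pos hD
  have hlL : 0 < Real.log L := Real.log_pos hL1
  set α := Real.log D / Real.log L with hα
  have hα0 : 0 < α := div_pos hlD hlL
  -- The last admissible time: `L ^ n ≤ 1 / (2 * δ) < L ^ (n + 1)`. Since `D = L ^ α`, the second
  -- inequality gives `D ^ (-n) ≤ (2 * L * δ) ^ α`.
  obtain ⟨n, hn1, hn2⟩ := exists_nat_pow_near (x := 1 / (2 * δ)) (y := L)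
    (by rw [one_le_div (by positivity)]; linarith) hL1
  rw [le_div_iff₀ (by positivity)] at hn1
  rw [div_lt_iff₀ (by positivity)] at hn2
  have hDL : D = L ^ α := by
    rw [Real.rpow_def_of_pos (by linarith), hα, mul_div_cancel₀ _ hlL.ne',
      Real.exp_log (by linarith)]
  refine (h n (by linarith)).trans ?_
  rw [mul_assoc, div_eq_mul_inv, ← Real.mul_rpow (by positivity) hδ.le]
  gcongr
  have hDn : D ^ n = (L ^ n) ^ α := by
    conv_lhs => rw [hDL]
    rw [← Real.rpow_natCast, ← Real.rpow_mul (by positivity), mul_comm α,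
      Real.rpow_mul (by positivity), Real.rpow_natCast]
  rw [hDn, ← Real.inv_rpow (by positivity)]
  refine Real.rpow_le_rpow (by positivity) ?_ hα0.le
  rw [inv_le_iff_one_le_mul₀ (by positivity)]
  rw [pow_succ] at hn2
  linarith

namespace HenonLike

variable {P : Type*} [TopologicalSpace P] {s : Fin 2} {R : ℝ} {D : ℕ} {Φ : P → C2 → C2}

/-- Local Hölder estimates for the rate of escape, uniform in the parameters. -/
lemma exists_holder (h : HenonLike s R D Φ) (hR : 1 ≤ R) (hD : 2 ≤ D) (ρ : ℝ) :
    ∃ C α : ℝ, 0 ≤ C ∧ 0 < α ∧ α ≤ 1 ∧ ∀ (Λ : ℕ → P) (z w : C2), ‖z‖ ≤ ρ → ‖w‖ ≤ ρ →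
      ‖z - w‖ ≤ 1 / 2 → |escapeRate Φ D Λ z - escapeRate Φ D Λ w| ≤ C * ‖z - w‖ ^ α := by
  have hD' : (1 : ℝ) < D := by exact_mod_cast (by omega : 1 < D)
  obtain ⟨C, hC, h1⟩ := h.exists_escapeApprox_bound hR hD ρ
  obtain ⟨L, hL, h2⟩ := h.norm_orbit_sub_le hR ρ
  have hL1 : 1 < L := hD'.trans_le hL
  -- Two truncation errors `C / D ^ n` and one comparison of approximations at time `n`, costing `1
  -- / D ^ n`.
  refine ⟨(2 * C + 1) * (2 * L) ^ (Real.log D / Real.log L), Real.log D / Real.log L,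
    by positivity, div_pos (Real.log_pos hD') (Real.log_pos hL1),
    (div_le_one (Real.log_pos hL1)).2 (Real.log_le_log (by linarith) hL),
    fun Λ z w hz hw hzw => ?_⟩
  rcases eq_or_ne z w with rfl | hne
  · have : 0 < Real.log D / Real.log L := div_pos (Real.log_pos hD') (Real.log_pos hL1)
    simp [Real.zero_rpow this.ne']
  refine le_rpow_of_forall_pow_le hD' hL (by positivity) (norm_pos_iff.2 (sub_ne_zero.2 hne)) hzw
    fun n hn => ?_
  have h3 := posLog_sub_posLog_le (norm_nonneg (orbit Φ Λ n z)) (norm_nonneg (orbit Φ Λ n w))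
    ((abs_norm_sub_norm_le _ _).trans (h2 Λ z w hz hw n)) hn
  have h4 : |escapeApprox Φ D Λ n z - escapeApprox Φ D Λ n w| ≤ 1 / (D : ℝ) ^ n := by
    rw [escapeApprox, escapeApprox, ← mul_sub, abs_mul, abs_of_pos (by positivity)]
    exact mul_le_of_le_one_right (by positivity) (h3.trans (by linarith))
  have h5 := abs_le.1 ((h1 Λ z hz).2 n)
  have h6 := abs_le.1 ((h1 Λ w hw).2 n)
  have h7 := abs_le.1 h4
  have h8 : (2 * C + 1) / (D : ℝ) ^ n = 2 * (C / (D : ℝ) ^ n) + 1 / (D : ℝ) ^ n := by ring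
  rw [h8, abs_le]
  constructor <;> linarith

end HenonLike

/-! ### Averaging over the random parameters -/

lemma LocallyHolder.continuous {u : C2 → ℝ} (hu : LocallyHolder u) : Continuous u := by
  refine continuous_iff_continuousAt.2 fun z => ?_
  obtain ⟨U, hU, C, r, hr, _, h⟩ := hu z
  exact (h.continuousOn hr).continuousAt hU

/-- A nonempty open set contains a nonempty box constrained in finitely many coordinates, whose
measure is a finite product of positive numbers. -/
lemma isOpenPosMeasure_infinitePi {P : Type*} [TopologicalSpace P] [MeasurableSpace P]
    [BorelSpace P] (ν : Measure P) [IsProbabilityMeasure ν] [ν.IsOpenPosMeasure] :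
    (Measure.infinitePi fun _ : ℕ => ν).IsOpenPosMeasure := by
  refine ⟨fun U hU ⟨Λ, hΛ⟩ => ?_⟩
  obtain ⟨I, u, hu, hsub⟩ := isOpen_pi_iff.1 hU Λ hΛ
  set u' : ℕ → Set P := fun i => if i ∈ I then u i else univ with hu'
  have h1 : ∀ i, IsOpen (u' i) := fun i => by
    by_cases hi : i ∈ I
    · simpa [hu', hi] using (hu i hi).1
    · simp [hu', hi]
  have h2 : ∀ i, Λ i ∈ u' i := fun i => by
    by_cases hi : i ∈ I
    · simpa [hu', hi] using (hu i hi).2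
    · simp [hu', hi]
  have hle : (I : Set ℕ).pi u' ⊆ U := fun x hx => hsub fun i hi => by
    have := hx i hi
    simpa [hu', Finset.mem_coe.1 hi] using this
  refine fun h0 => ?_
  have h3 := measure_mono_null hle h0
  rw [Measure.infinitePi_pi _ fun i _ => (h1 i).measurableSet, Finset.prod_eq_zero_iff] at h3
  obtain ⟨i, _, hi⟩ := h3
  exact (h1 i).measure_ne_zero ν ⟨_, h2 i⟩ hi

namespace HenonLike

variable {P : Type*} [TopologicalSpace P] [SecondCountableTopology P]
  [MeasurableSpace P] [BorelSpace P] {s : Fin 2} {R : ℝ} {D : ℕ} {Φ : P → C2 → C2}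

/-- Second countability makes open sets of the sequence space measurable, so continuity in `Λ` gives
measurability; boundedness does the rest. -/
lemma integrable_escapeRate (h : HenonLike s R D Φ) (hR : 1 ≤ R) (hD : 2 ≤ D)
    (μ : Measure (ℕ → P)) [IsFiniteMeasure μ] (z : C2) :
    Integrable (fun Λ => escapeRate Φ D Λ z) μ := by
  obtain ⟨C, hC⟩ := h.exists_escapeRate_le hR hD ‖z‖
  refine Integrable.of_bound ?_ C (Eventually.of_forall fun Λ => (hC Λ z le_rfl).1)
  exact (h.continuous_escapeRate_comp hR hD continuous_id continuous_const).aestronglyMeasurable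

lemma locallyHolder_integral (h : HenonLike s R D Φ) (hR : 1 ≤ R) (hD : 2 ≤ D)
    (μ : Measure (ℕ → P)) [IsProbabilityMeasure μ] :
    LocallyHolder fun z => ∫ Λ, escapeRate Φ D Λ z ∂μ := by
  intro z₀
  obtain ⟨C, α, hC, hα, hα1, hh⟩ := h.exists_holder hR hD (‖z₀‖ + 1)
  lift C to NNReal using hC
  lift α to NNReal using hα.le
  refine ⟨ball z₀ (1 / 4), ball_mem_nhds _ (by norm_num), C, α, hα, hα1,
    fun z hz w hw => ?_⟩
  have hnorm : ∀ x ∈ ball z₀ (1 / 4), ‖x‖ ≤ ‖z₀‖ + 1 := fun x hx => by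
    have h1 : ‖x - z₀‖ < 1 / 4 := by simpa [dist_eq_norm] using hx
    have h2 := norm_le_norm_add_norm_sub' x z₀
    linarith
  have hzw : ‖z - w‖ ≤ 1 / 2 := by
    rw [← dist_eq_norm]
    have h1 := dist_triangle_right z w z₀
    rw [mem_ball] at hz hw
    linarith
  have key : dist (∫ Λ, escapeRate Φ D Λ z ∂μ) (∫ Λ, escapeRate Φ D Λ w ∂μ)
      ≤ C * dist z w ^ (α : ℝ) := by
    rw [dist_eq_norm, dist_eq_norm,
      ← integral_sub (h.integrable_escapeRate hR hD μ z) (h.integrable_escapeRate hR hD μ w)]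
    refine (norm_integral_le_of_norm_le_const (C := C * ‖z - w‖ ^ (α : ℝ))
      (Eventually.of_forall fun Λ => hh Λ z w (hnorm z hz) (hnorm w hw) hzw)).trans ?_
    simp
  rw [edist_dist, edist_dist, ENNReal.ofReal_rpow_of_nonneg dist_nonneg hα.le,
    ← ENNReal.ofReal_coe_nnreal (p := C), ← ENNReal.ofReal_mul C.coe_nonneg]
  exact ENNReal.ofReal_le_ofReal key

/-- Weighted circle averages of the mean rate of escape. -/
lemma circleAverage_integral_escapeRate (h : HenonLike s R D Φ) (hR : 1 ≤ R) (hD : 2 ≤ D)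
    (μ : Measure (ℕ → P)) [IsProbabilityMeasure μ] (a b : C2) {κ : ℂ → ℝ}
    (hκ : ContinuousOn κ (sphere 0 1)) :
    Real.circleAverage (κ • fun ζ : ℂ => ∫ Λ, escapeRate Φ D Λ (a + ζ • b) ∂μ) 0 1
      = ∫ Λ, Real.circleAverage (κ • fun ζ : ℂ => escapeRate Φ D Λ (a + ζ • b)) 0 1 ∂μ := by
  obtain ⟨C, hC⟩ := h.exists_escapeRate_le hR hD (‖a‖ + ‖b‖)
  obtain ⟨K, hK⟩ := ((isCompact_sphere (0 : ℂ) 1).image_of_continuousOn hκ).isBounded.exists_norm_le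
  have hκ' : Continuous fun θ : ℝ => κ (circleMap 0 1 θ) :=
    hκ.comp_continuous (continuous_circleMap 0 1) fun θ => circleMap_mem_sphere 0 zero_le_one θ
  have hcm := continuous_circleMap 0 1
  have hline : Continuous fun p : (ℕ → P) × ℝ => a + circleMap 0 1 p.2 • b := by fun_prop
  have hmeas : Continuous fun p : (ℕ → P) × ℝ =>
      κ (circleMap 0 1 p.2) * escapeRate Φ D p.1 (a + circleMap 0 1 p.2 • b) :=
    (hκ'.comp continuous_snd).mul (h.continuous_escapeRate_comp hR hD continuous_fst hline)
  have hbound : ∀ (Λ : ℕ → P), ∀ ζ ∈ sphere (0 : ℂ) 1,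
      |κ ζ * escapeRate Φ D Λ (a + ζ • b)| ≤ K * C := fun Λ ζ hζ => by
    have h3 : |κ ζ| ≤ K := hK _ ⟨ζ, hζ, rfl⟩
    have h4 : |escapeRate Φ D Λ (a + ζ • b)| ≤ C :=
      (hC Λ (a + ζ • b) (norm_affine_le (sphere_subset_closedBall hζ))).1
    rw [abs_mul]
    exact mul_le_mul h3 h4 (abs_nonneg _) ((abs_nonneg _).trans h3)
  have hmul : (κ • fun ζ : ℂ => ∫ Λ, escapeRate Φ D Λ (a + ζ • b) ∂μ)
      = fun ζ => ∫ Λ, κ ζ * escapeRate Φ D Λ (a + ζ • b) ∂μ := by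
    ext ζ
    exact (integral_const_mul _ _).symm
  rw [hmul]
  exact circleAverage_integral μ (fun Λ ζ => κ ζ * escapeRate Φ D Λ (a + ζ • b)) (K * C)
    hmeas.aestronglyMeasurable hbound

lemma plurisubharmonic_integral (h : HenonLike s R D Φ) (hR : 1 ≤ R) (hD : 2 ≤ D)
    (μ : Measure (ℕ → P)) [IsProbabilityMeasure μ] :
    Plurisubharmonic fun z => ∫ Λ, escapeRate Φ D Λ z ∂μ := by
  have hcont := (h.locallyHolder_integral hR hD μ).continuous
  refine ⟨hcont.upperSemicontinuous, fun a b => ⟨?_, ?_⟩⟩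
  · exact (hcont.comp (by fun_prop : Continuous fun ζ : ℂ => a + ζ • b)).continuousOn.circleIntegrable
      zero_le_one
  · have h1 := h.circleAverage_integral_escapeRate hR hD μ a b (κ := 1) continuousOn_const
    simp only [one_smul] at h1
    rw [h1]
    refine integral_mono (h.integrable_escapeRate hR hD μ a) ?_
      (h.escapeRate_le_circleAverage hR hD · a b)
    -- What remains is integrability of the fibrewise circle averages, which are continuous in `Λ`
    -- and bounded by `C`.
    obtain ⟨C, hC⟩ := h.exists_escapeRate_le hR hD (‖a‖ + ‖b‖)
    have hcm := continuous_circleMap 0 1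
    have hline : Continuous fun p : (ℕ → P) × ℝ => a + circleMap 0 1 p.2 • b := by fun_prop
    have hf : Continuous fun p : (ℕ → P) × ℝ =>
        escapeRate Φ D p.1 (a + circleMap 0 1 p.2 • b) :=
      h.continuous_escapeRate_comp hR hD continuous_fst hline
    have hint : Continuous fun Λ : ℕ → P => ∫ θ in (0)..(2 * Real.pi),
        escapeRate Φ D Λ (a + circleMap 0 1 θ • b) :=
      intervalIntegral.continuous_parametric_intervalIntegral_of_continuous' (μ := volume)
        (f := fun Λ θ => escapeRate Φ D Λ (a + circleMap 0 1 θ • b)) hf 0 (2 * Real.pi)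
    have havg : Continuous fun Λ : ℕ → P =>
        Real.circleAverage (fun ζ : ℂ => escapeRate Φ D Λ (a + ζ • b)) 0 1 := by
      have := continuous_const (y := (2 * Real.pi)⁻¹) |>.mul hint
      exact this
    refine Integrable.of_bound havg.aestronglyMeasurable C (Eventually.of_forall fun Λ => ?_)
    have hc : Continuous fun ζ : ℂ => escapeRate Φ D Λ (a + ζ • b) :=
      h.continuous_escapeRate_comp hR hD continuous_const (by fun_prop)
    rw [Real.norm_eq_abs]
    have hci : CircleIntegrable |fun ζ : ℂ => escapeRate Φ D Λ (a + ζ • b)| 0 1 :=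
      hc.abs.continuousOn.circleIntegrable zero_le_one
    refine Real.abs_circleAverage_le_circleAverage_abs.trans
      (Real.circleAverage_mono_on_of_le_circle hci fun ζ hζ => ?_)
    have hζ' : ζ ∈ closedBall (0 : ℂ) 1 := sphere_subset_closedBall (by simpa using hζ)
    rw [Pi.abs_apply]
    exact (hC Λ (a + ζ • b) (norm_affine_le hζ')).1

/-- The Poisson formula is linear, so it survives integration; the time of entry into the cone need
not be uniform in `Λ`. -/
lemma pluriharmonicOn_integral (h : HenonLike s R D Φ) (hR : 1 ≤ R) (hD : 2 ≤ D)
    (μ : Measure (ℕ → P)) [IsProbabilityMeasure μ] {Ω : Set C2} (hΩ : IsOpen Ω)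
    (hesc : ∀ z ∈ Ω, ∀ Λ : ℕ → P, ∃ n, orbit Φ Λ n z ∈ cone s R) :
    PluriharmonicOn (fun z => ∫ Λ, escapeRate Φ D Λ z ∂μ) Ω := by
  set u : C2 → ℝ := fun z => ∫ Λ, escapeRate Φ D Λ z ∂μ with hu
  have hcont : Continuous u := (h.locallyHolder_integral hR hD μ).continuous
  have hpoisson : ∀ a b : C2, (∀ ζ ∈ closedBall (0 : ℂ) 1, a + ζ • b ∈ Ω) →
      ∀ w ∈ ball (0 : ℂ) 1, Real.circleAverage ((Complex.re ∘ herglotzRieszKernel 0 w) •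
        fun ζ : ℂ => u (a + ζ • b)) 0 1 = u (a + w • b) := by
    intro a b hab w hw
    rw [hu, h.circleAverage_integral_escapeRate hR hD μ a b (continuousOn_re_herglotzRieszKernel hw)]
    exact integral_congr_ae (Eventually.of_forall fun Λ =>
      h.circleAverage_escapeRate hR hD Λ (fun ζ hζ => hesc _ (hab ζ hζ) Λ) hw)
  have hdisc : ∀ a₀ ∈ Ω, ∃ r > 0, ∀ a ∈ ball a₀ r, ∀ b : C2, ‖b‖ ≤ r →
      ∀ ζ ∈ closedBall (0 : ℂ) 1, a + ζ • b ∈ Ω := by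
    intro a₀ ha₀
    obtain ⟨e, he, hball⟩ := Metric.isOpen_iff.1 hΩ a₀ ha₀
    refine ⟨e / 2, by positivity, fun a ha b hb ζ hζ => hball ?_⟩
    have h1 : ‖ζ‖ ≤ 1 := by simpa using hζ
    have h2 : ‖ζ • b‖ ≤ e / 2 := by
      rw [norm_smul]
      nlinarith [norm_nonneg b]
    have h3 : ‖a - a₀‖ < e / 2 := by simpa [dist_eq_norm] using ha
    rw [mem_ball, dist_eq_norm, add_sub_right_comm]
    linarith [norm_add_le (a - a₀) (ζ • b)]
  refine ⟨fun a₀ ha₀ => ContDiffAt.contDiffWithinAt ?_, fun a ha b => ?_⟩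
  · obtain ⟨r, hr, hd⟩ := hdisc a₀ ha₀
    refine contDiffAt_of_circleAverage_eq hcont hr fun a ha b hb => ?_
    -- At `w = 0` the kernel is `1` on the circle, and the Poisson formula becomes the mean value
    -- property.
    have h1 := hpoisson a b (hd a ha b hb) 0 (by simp)
    simp only [zero_smul, add_zero] at h1
    rw [← h1]
    refine Real.circleAverage_congr_sphere fun ζ hζ => ?_
    have : ζ ≠ 0 := by rintro rfl; simp at hζ
    simp [herglotzRieszKernel_def, this]
  · obtain ⟨r, hr, hd⟩ := hdisc a ha
    -- The direction `b` is shrunk so that the unit disc stays in `Ω`; the scaling is undone by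
    -- composing with `ζ ↦ ζ * τ⁻¹`.
    set τ : ℝ := r / (‖b‖ + 1) with hτ
    have hτ0 : 0 < τ := by positivity
    have hτb : ‖(τ : ℂ) • b‖ ≤ r := by
      rw [norm_smul, Complex.norm_real, Real.norm_of_nonneg hτ0.le, hτ, div_mul_eq_mul_div,
        div_le_iff₀ (by positivity)]
      nlinarith
    obtain ⟨f, hf, hfu⟩ := exists_analyticAt_re_eq_of_poisson
      (v := fun ζ : ℂ => u (a + ζ • (τ : ℂ) • b)) (hcont.comp (by fun_prop))
      (hpoisson a _ (hd a (mem_ball_self hr) _ hτb))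
    have hlin : Tendsto (fun ζ : ℂ => ζ * (τ : ℂ)⁻¹) (𝓝 0) (𝓝 0) := by
      have : Continuous fun ζ : ℂ => ζ * (τ : ℂ)⁻¹ := by fun_prop
      simpa using this.tendsto 0
    have hτc : (τ : ℂ) ≠ 0 := Complex.ofReal_ne_zero.2 hτ0.ne'
    have hg : AnalyticAt ℂ (fun ζ : ℂ => f (ζ * (τ : ℂ)⁻¹)) 0 :=
      AnalyticAt.fun_comp (by simpa using hf) (by fun_prop)
    refine (harmonicAt_congr_nhds ?_).2 hg.harmonicAt_re
    filter_upwards [hlin.eventually hfu] with ζ hζ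
    rw [← hζ, smul_smul, inv_mul_cancel_right₀ hτc]

end HenonLike

/-! ### Elementary Hénon maps are Hénon-like -/

lemma norm_pow_sub_pow_le {x y : ℂ} {M : ℝ} (hx : ‖x‖ ≤ M) (hy : ‖y‖ ≤ M) (n : ℕ) :
    ‖x ^ (n + 1) - y ^ (n + 1)‖ ≤ (n + 1) * M ^ n * ‖x - y‖ := by
  have hM : 0 ≤ M := (norm_nonneg x).trans hx
  induction n with
  | zero => simp
  | succ n ih =>
    calc ‖x ^ (n + 1 + 1) - y ^ (n + 1 + 1)‖
        = ‖x ^ (n + 1) * (x - y) + (x ^ (n + 1) - y ^ (n + 1)) * y‖ := by ring_nf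
      _ ≤ ‖x‖ ^ (n + 1) * ‖x - y‖ + ‖x ^ (n + 1) - y ^ (n + 1)‖ * ‖y‖ := by
          refine (norm_add_le _ _).trans ?_
          rw [norm_mul, norm_mul, norm_pow]
      _ ≤ M ^ (n + 1) * ‖x - y‖ + (n + 1) * M ^ n * ‖x - y‖ * M := by gcongr
      _ = _ := by push_cast; ring

lemma exists_norm_bound {P : Type*} [TopologicalSpace P] [CompactSpace P] {f : P → ℂ}
    (hf : Continuous f) : ∃ A : ℝ, 0 ≤ A ∧ ∀ t, ‖f t‖ ≤ A := by
  obtain ⟨A, hA⟩ := isCompact_univ.exists_bound_of_continuousOn hf.continuousOn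
  exact ⟨max 0 A, le_max_left _ _, fun t => (hA t (mem_univ t)).trans (le_max_right _ _)⟩

section Elementary

variable {P : Type*} [TopologicalSpace P] [CompactSpace P] {s s' : Fin 2} {d : ℕ}
  {Φ : P → C2 → C2} {c : ℕ → P → ℂ} {b : P → ℂ}

/-- A compact family of elementary maps `(x, y) ↦ (y, q(y) - b x)`, up to a permutation of the
coordinates, is Hénon-like for every large radius. -/
lemma eventually_henonLike (hs : ∀ i, i = s ∨ i = s') (hd : 2 ≤ d) (hc : ∀ i, Continuous (c i))
    (hc0 : ∀ t, c d t ≠ 0) (hb : Continuous b)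
    (h1 : ∀ t z, Φ t z s = ∑ i ∈ Finset.range (d + 1), c i t * z s ^ i - b t * z s')
    (h2 : ∀ t z, Φ t z s' = z s) : ∀ᶠ R in atTop, HenonLike s R d Φ := by
  obtain ⟨g, hg0, hg⟩ := exists_norm_bound ((hc d).inv₀ hc0)
  obtain ⟨A₀, hA₀, hA'⟩ := exists_norm_bound (f := fun t =>
    ((∑ i ∈ Finset.range (d + 1), ‖c i t‖ + ‖b t‖ : ℝ) : ℂ)) (by fun_prop)
  set A := A₀ + 1 with hAdef
  have hA1 : 1 ≤ A := by linarith
  have hA : ∀ t, ∑ i ∈ Finset.range (d + 1), ‖c i t‖ + ‖b t‖ ≤ A := fun t => by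
    have := hA' t
    rw [Complex.norm_real, Real.norm_of_nonneg (by positivity)] at this
    linarith
  set γ := (g + 1)⁻¹ with hγdef
  have hγ : 0 < γ := by positivity
  have hlead : ∀ t, γ ≤ ‖c d t‖ := fun t => by
    have h3 := hg t
    rw [Pi.inv_apply, norm_inv] at h3
    have h4 : 0 < ‖c d t‖ := norm_pos_iff.2 (hc0 t)
    rw [hγdef]
    exact inv_le_of_inv_le₀ h4 (by linarith)
  have hsum : ∀ t, ∀ M : ℝ, 1 ≤ M → ∀ x y : ℂ, ‖x‖ ≤ M → ‖y‖ ≤ M →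
      ‖∑ i ∈ Finset.range (d + 1), c i t * y ^ i - b t * x‖ ≤ A * M ^ d := by
    intro t M hM x y hx hy
    calc ‖∑ i ∈ Finset.range (d + 1), c i t * y ^ i - b t * x‖
        ≤ ∑ i ∈ Finset.range (d + 1), ‖c i t‖ * M ^ d + ‖b t‖ * M ^ d := by
          refine (norm_sub_le _ _).trans (add_le_add ((norm_sum_le _ _).trans
            (Finset.sum_le_sum fun i hi => ?_)) ?_)
          · rw [norm_mul, norm_pow]
            have : i ≤ d := by simpa [Nat.lt_succ_iff] using hi
            gcongr
            exact (pow_le_pow_left₀ (norm_nonneg _) hy i).trans (pow_le_pow_right₀ hM this)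
          · rw [norm_mul]
            gcongr
            exact hx.trans (le_self_pow₀ hM (by omega))
      _ = (∑ i ∈ Finset.range (d + 1), ‖c i t‖ + ‖b t‖) * M ^ d := by
          rw [add_mul, Finset.sum_mul]
      _ ≤ _ := by gcongr; exact hA t
  have hlow : ∀ t, ∀ x y : ℂ, ‖x‖ ≤ ‖y‖ → 1 ≤ ‖y‖ →
      γ * ‖y‖ ^ d - A * ‖y‖ ^ (d - 1)
        ≤ ‖∑ i ∈ Finset.range (d + 1), c i t * y ^ i - b t * x‖ := by
    intro t x y hxy hy
    have h3 : ‖∑ i ∈ Finset.range d, c i t * y ^ i - b t * x‖ ≤ A * ‖y‖ ^ (d - 1) := by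
      calc ‖∑ i ∈ Finset.range d, c i t * y ^ i - b t * x‖
          ≤ ∑ i ∈ Finset.range d, ‖c i t‖ * ‖y‖ ^ (d - 1) + ‖b t‖ * ‖y‖ ^ (d - 1) := by
            refine (norm_sub_le _ _).trans (add_le_add ((norm_sum_le _ _).trans
              (Finset.sum_le_sum fun i hi => ?_)) ?_)
            · rw [norm_mul, norm_pow]
              have : i < d := by simpa using hi
              gcongr
              omega
            · rw [norm_mul]
              gcongr
              exact hxy.trans (le_self_pow₀ hy (by omega))
        _ = (∑ i ∈ Finset.range d, ‖c i t‖ + ‖b t‖) * ‖y‖ ^ (d - 1) := by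
            rw [add_mul, Finset.sum_mul]
        _ ≤ _ := by
            gcongr
            refine le_trans ?_ (hA t)
            rw [Finset.sum_range_succ]
            linarith [norm_nonneg (c d t)]
    have h4 : ∑ i ∈ Finset.range (d + 1), c i t * y ^ i - b t * x
        = c d t * y ^ d + (∑ i ∈ Finset.range d, c i t * y ^ i - b t * x) := by
      rw [Finset.sum_range_succ]; ring
    have h5 : γ * ‖y‖ ^ d ≤ ‖c d t * y ^ d‖ := by
      rw [norm_mul, norm_pow]
      gcongr
      exact hlead t
    rw [h4]
    have h6 := norm_sub_le (c d t * y ^ d + (∑ i ∈ Finset.range d, c i t * y ^ i - b t * x))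
      (∑ i ∈ Finset.range d, c i t * y ^ i - b t * x)
    rw [add_sub_cancel_right] at h6
    linarith
  -- Beyond `2 * A / γ` the lower-order terms take at most half of the leading term; beyond `2 * d /
  -- γ` the remaining half expands by the factor `d`.
  filter_upwards [eventually_ge_atTop 1, eventually_ge_atTop (2 * A / γ),
    eventually_ge_atTop (2 * d / γ)] with R hR1 hR2 hR3
  rw [div_le_iff₀ hγ] at hR2 hR3
  have hlower : ∀ t, ∀ z ∈ cone s R, γ / 2 * ‖z s‖ ^ d ≤ ‖Φ t z s‖ := by
    intro t z hz
    have hy : 1 ≤ ‖z s‖ := hR1.trans hz.1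
    rw [h1]
    refine le_trans ?_ (hlow t _ _ (hz.2 s') hy)
    have h3 : A * ‖z s‖ ^ (d - 1) ≤ γ / 2 * ‖z s‖ ^ d := by
      calc A * ‖z s‖ ^ (d - 1) ≤ γ / 2 * ‖z s‖ * ‖z s‖ ^ (d - 1) := by
            gcongr
            nlinarith [hz.1]
        _ = γ / 2 * ‖z s‖ ^ d := by
            conv_rhs => rw [← Nat.sub_add_cancel (by omega : 1 ≤ d), pow_succ]
            ring
    linarith
  have hexpand : ∀ t, ∀ z ∈ cone s R, d * ‖z s‖ ≤ ‖Φ t z s‖ := by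
    intro t z hz
    have hy : 1 ≤ ‖z s‖ := hR1.trans hz.1
    refine le_trans ?_ (hlower t z hz)
    calc (d : ℝ) * ‖z s‖ ≤ (γ / 2 * ‖z s‖) * ‖z s‖ := by
          gcongr
          nlinarith [hz.1]
      _ = γ / 2 * ‖z s‖ ^ 2 := by ring
      _ ≤ γ / 2 * ‖z s‖ ^ d := by gcongr
  have hd1 : (1 : ℝ) ≤ d := by exact_mod_cast (by omega : 1 ≤ d)
  have hcontΦ : Continuous fun q : P × C2 => Φ q.1 q.2 := by
    have h3 : Continuous fun q : P × C2 => (Φ q.1 q.2).ofLp := by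
      refine continuous_pi fun i => ?_
      have hz : ∀ j, Continuous fun q : P × C2 => q.2 j := fun j =>
        (PiLp.continuous_apply 2 _ j).comp continuous_snd
      rcases hs i with rfl | rfl
      · simp only [h1]
        exact (continuous_finsetSum _ fun j _ =>
          ((hc j).comp continuous_fst).mul ((hz i).pow j)).sub ((hb.comp continuous_fst).mul (hz _))
      · simp only [h2]
        exact hz _
    exact (PiLp.continuous_toLp 2 _).comp h3
  refine ⟨by omega, hcontΦ, fun t => ?_, fun t z hz => ?_, hexpand, ⟨γ / 2, by positivity, hlower⟩,
    ⟨2 * A, by linarith, fun t z => ?_⟩, ⟨2 * (A * d), by positivity, fun t z w => ?_⟩, ?_⟩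
  · refine differentiable_euclidean.2 fun i => ?_
    have hz : ∀ j, Differentiable ℂ fun z : C2 => z j := fun j =>
      (EuclideanSpace.proj (𝕜 := ℂ) j).differentiable
    rcases hs i with rfl | rfl
    · simp only [h1]
      exact (Differentiable.fun_sum fun j _ =>
        (differentiable_const _).mul ((hz i).pow j)).sub ((differentiable_const _).mul (hz _))
    · simp only [h2]
      exact hz _
  · have h3 : ‖z s‖ ≤ ‖Φ t z s‖ :=
      (le_mul_of_one_le_left (norm_nonneg _) hd1).trans (hexpand t z hz)
    refine ⟨hz.1.trans h3, fun i => ?_⟩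
    rcases hs i with rfl | rfl
    · exact le_rfl
    · rwa [h2]
  · set M := max 1 ‖z‖ with hM
    have hM1 : 1 ≤ M := le_max_left _ _
    have hzM : ∀ i, ‖z i‖ ≤ M := fun i => (norm_apply_le_norm z i).trans (le_max_right _ _)
    have hMd : M ≤ M ^ d := le_self_pow₀ hM1 (by omega)
    have h3 : ‖Φ t z‖ ≤ 2 * (A * M ^ d) := norm_le_two_mul fun i => by
      rcases hs i with rfl | rfl
      · rw [h1]
        exact hsum t M hM1 _ _ (hzM _) (hzM _)
      · rw [h2]
        nlinarith [hzM s]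
    refine max_le ?_ (by linarith)
    nlinarith
  · set M := max 1 (max ‖z‖ ‖w‖) with hM
    have hM1 : 1 ≤ M := le_max_left _ _
    have hzM : ∀ i, ‖z i‖ ≤ M := fun i => (norm_apply_le_norm z i).trans
      ((le_max_left _ _).trans (le_max_right _ _))
    have hwM : ∀ i, ‖w i‖ ≤ M := fun i => (norm_apply_le_norm w i).trans
      ((le_max_right _ _).trans (le_max_right _ _))
    have hsub : ∀ i, ‖z i - w i‖ ≤ ‖z - w‖ := fun i => norm_apply_le_norm (z - w) i
    have hMd1 : 1 ≤ M ^ (d - 1) := one_le_pow₀ hM1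
    have hB : 1 ≤ d * M ^ (d - 1) := one_le_mul_of_one_le_of_one_le hd1 hMd1
    have hpow : ∀ i ∈ Finset.range (d + 1),
        ‖z s ^ i - w s ^ i‖ ≤ d * M ^ (d - 1) * ‖z - w‖ := by
      intro i hi
      rcases i with _ | i
      · simp; positivity
      · have hid : i + 1 ≤ d := by simpa [Nat.lt_succ_iff] using hi
        refine (norm_pow_sub_pow_le (hzM s) (hwM s) i).trans ?_
        have : (i + 1 : ℝ) ≤ d := by exact_mod_cast hid
        gcongr
        · omega
        · exact hsub s
    have h3 : ‖Φ t z - Φ t w‖ ≤ 2 * (A * (d * M ^ (d - 1) * ‖z - w‖)) :=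
      norm_le_two_mul fun i => by
      rw [PiLp.sub_apply]
      rcases hs i with rfl | rfl
      · rw [h1, h1]
        calc ‖(∑ j ∈ Finset.range (d + 1), c j t * z i ^ j - b t * z s')
              - (∑ j ∈ Finset.range (d + 1), c j t * w i ^ j - b t * w s')‖
            = ‖∑ j ∈ Finset.range (d + 1), c j t * (z i ^ j - w i ^ j)
              - b t * (z s' - w s')‖ := by
              simp only [mul_sub, Finset.sum_sub_distrib]
              congr 1; ring
          _ ≤ ∑ j ∈ Finset.range (d + 1), ‖c j t‖ * (d * M ^ (d - 1) * ‖z - w‖)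
              + ‖b t‖ * (d * M ^ (d - 1) * ‖z - w‖) := by
              refine (norm_sub_le _ _).trans (add_le_add ((norm_sum_le _ _).trans
                (Finset.sum_le_sum fun j hj => ?_)) ?_)
              · rw [norm_mul]
                exact mul_le_mul_of_nonneg_left (hpow j hj) (norm_nonneg _)
              · rw [norm_mul]
                refine mul_le_mul_of_nonneg_left ((hsub s').trans ?_) (norm_nonneg _)
                exact le_mul_of_one_le_left (norm_nonneg _) hB
          _ = (∑ j ∈ Finset.range (d + 1), ‖c j t‖ + ‖b t‖) * (d * M ^ (d - 1) * ‖z - w‖) := by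
              rw [add_mul, Finset.sum_mul]
          _ ≤ _ := by gcongr; exact hA t
      · rw [h2, h2]
        refine (hsub s).trans ?_
        rw [← mul_assoc]
        exact le_mul_of_one_le_left (norm_nonneg _) (one_le_mul_of_one_le_of_one_le hA1 hB)
    refine h3.trans (le_of_eq ?_)
    ring
  -- Coordinate `s'` of the image is an old coordinate. If coordinate `s` exceeded `r`, it would
  -- dominate and put the image in the cone.
  · intro t z r hr hz hout i
    rcases hs i with rfl | rfl
    · by_contra! hlt
      refine hout ⟨hr.trans hlt.le, fun j => ?_⟩
      rcases hs j with rfl | rfl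
      · exact le_rfl
      · rw [h2]
        exact (hz i).trans hlt.le
    · rw [h2]
      exact hz s

end Elementary

/-! ### Application to the given family and its inverses -/

namespace HenonFamily

variable {P : Type*} [TopologicalSpace P] (F : HenonFamily P)

lemma two_le_degree : 2 ≤ F.degree :=
  (F.two_le_deg ⟨0, F.m_pos⟩).trans (Finset.single_le_prod'
    (fun j _ => one_le_two.trans (F.two_le_deg j)) (Finset.mem_univ _))

/-- Stating the property for all large `R` lets finitely many factors share one radius, as `comp`
requires. -/
lemma eventually_henonLike_list_prod {s : Fin 2} {f : P → Fin F.m → Equiv.Perm C2}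
    (h : ∀ j, ∀ᶠ R in atTop, HenonLike s R (F.deg j) fun t z => f t j z) (l : List (Fin F.m)) :
    ∀ᶠ R in atTop, HenonLike s R (l.map F.deg).prod fun t z => (l.map (f t)).prod z := by
  induction l with
  | nil => exact Eventually.of_forall fun R => HenonLike.id
  | cons j l ih =>
    filter_upwards [h j, ih] with R h1 h2
    simpa using h1.comp h2

lemma eval_p (j : Fin F.m) (t : P) (y : ℂ) :
    (F.p j t).eval y = ∑ i ∈ Finset.range (F.deg j + 1), (F.p j t).coeff i * y ^ i := by
  rw [eval_eq_sum_range, F.natDegree_eq]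

lemma coeff_deg (j : Fin F.m) (t : P) : (F.p j t).coeff (F.deg j) = 1 := by
  rw [← F.natDegree_eq j t]
  exact F.monic j t

/-- For the inverse, the factors appear in the opposite order and the leading coefficient is `1 /
a`, bounded away from zero by compactness. -/
lemma exists_henonLike [CompactSpace P] (ε : ℤˣ) :
    ∃ s R, 1 ≤ R ∧ HenonLike s R F.degree fun t z => (F.map t ^ (ε : ℤ)) z := by
  rcases Int.units_eq_one_or ε with rfl | rfl
  · have h : ∀ j, ∀ᶠ R in atTop, HenonLike 1 R (F.deg j) fun t z => F.factor t j z := fun j =>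
      eventually_henonLike (s' := 0) (c := fun i t => (F.p j t).coeff i) (b := F.a j)
        (by decide) (F.two_le_deg j) (F.continuous_coeff j)
        (fun t => by simp [F.coeff_deg]) (F.continuous_a j)
        (fun t z => by simp [factor, henonMap, F.eval_p]) (fun t z => by simp [factor, henonMap])
    obtain ⟨R, h1, h2⟩ := ((F.eventually_henonLike_list_prod h (List.finRange F.m).reverse).and
      (eventually_ge_atTop 1)).exists
    refine ⟨1, R, h2, ?_⟩
    have h3 : ((List.finRange F.m).reverse.map F.deg).prod = F.degree := by
      rw [List.map_reverse, List.prod_reverse, ← List.ofFn_eq_map, List.prod_ofFn, degree]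
    rw [h3] at h1
    simpa [map, List.ofFn_eq_map, List.map_reverse] using h1
  · have h : ∀ j, ∀ᶠ R in atTop, HenonLike 0 R (F.deg j) fun t z => (F.factor t j)⁻¹ z := fun j =>
      eventually_henonLike (s' := 1) (c := fun i t => (F.p j t).coeff i / F.a j t)
        (b := fun t => (F.a j t)⁻¹)
        (by decide) (F.two_le_deg j)
        (fun i => (F.continuous_coeff j i).div (F.continuous_a j) (F.a_ne_zero j))
        (fun t => by simp [F.coeff_deg, F.a_ne_zero j t])
        ((F.continuous_a j).inv₀ (F.a_ne_zero j))
        (fun t z => by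
          change ((F.p j t).eval (z 0) - z 1) / F.a j t = _
          rw [F.eval_p, sub_div, Finset.sum_div]
          congr 1
          · exact Finset.sum_congr rfl fun i _ => by ring
          · ring)
        (fun t z => rfl)
    obtain ⟨R, h1, h2⟩ := ((F.eventually_henonLike_list_prod h (List.finRange F.m)).and
      (eventually_ge_atTop 1)).exists
    refine ⟨0, R, h2, ?_⟩
    have h3 : ((List.finRange F.m).map F.deg).prod = F.degree := by
      rw [← List.ofFn_eq_map, List.prod_ofFn, degree]
    rw [h3] at h1
    simpa [map, List.ofFn_eq_map, List.prod_inv_reverse, Function.comp_def] using h1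

lemma iter_apply (ε : ℤˣ) (Λ : ℕ → P) (n : ℕ) (z : C2) :
    F.iter ε Λ n z = orbit (fun t z => (F.map t ^ (ε : ℤ)) z) Λ n z := by
  induction n with
  | zero => rfl
  | succ n ih => simp only [iter, orbit, Equiv.Perm.mul_apply, ih]

lemma greenApprox_eq (ε : ℤˣ) (Λ : ℕ → P) (n : ℕ) (z : C2) :
    F.greenApprox ε Λ n z = escapeApprox (fun t z => (F.map t ^ (ε : ℤ)) z) F.degree Λ n z := by
  rw [greenApprox, escapeApprox, iter_apply]

lemma green_eq (ε : ℤˣ) (Λ : ℕ → P) (z : C2) :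
    F.green ε Λ z = escapeRate (fun t z => (F.map t ^ (ε : ℤ)) z) F.degree Λ z := by
  simp only [green, escapeRate, greenApprox_eq]

lemma averageGreen_eq [MeasurableSpace P] (ν : Measure P) [IsProbabilityMeasure ν] (ε : ℤˣ) :
    F.averageGreen ν ε = fun z => ∫ Λ, escapeRate (fun t z => (F.map t ^ (ε : ℤ)) z) F.degree Λ z
      ∂(Measure.infinitePi fun _ : ℕ => ν) := by
  ext z
  simp only [averageGreen, green_eq]

lemma mem_nonescaping_iff {ε : ℤˣ} {s : Fin 2} {R : ℝ} (hR : 1 ≤ R)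
    (h : HenonLike s R F.degree fun t z => (F.map t ^ (ε : ℤ)) z) (Λ : ℕ → P) (z : C2) :
    z ∈ F.nonescaping ε Λ ↔
      ∀ n, orbit (fun t z => (F.map t ^ (ε : ℤ)) z) Λ n z ∉ cone s R := by
  rw [← h.isBounded_orbit_iff hR F.two_le_degree, nonescaping]
  simp only [iter_apply]
  rfl

end HenonFamily

end RandomHenon
end

/-! ### Assembly of the theorem -/

theorem proposition1p2 {k : ℕ} (M : Set (EuclideanSpace ℂ (Fin k))) (hM : IsCompact M)
    (ν : Measure M) [IsProbabilityMeasure ν] (F : RandomHenon.HenonFamily M) (ε : ℤˣ) :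
    -- the Green functions and their average are well defined
    (∀ (Λ : ℕ → M) (z : RandomHenon.C2),
      Tendsto (fun n => F.greenApprox ε Λ n z) atTop (𝓝 (F.green ε Λ z))) ∧
    (∀ z : RandomHenon.C2,
      Integrable (fun Λ : ℕ → M => F.green ε Λ z) (Measure.infinitePi fun _ : ℕ => ν)) ∧
    -- regularity
    RandomHenon.LocallyHolder (F.averageGreen ν ε) ∧
    RandomHenon.Plurisubharmonic (F.averageGreen ν ε) ∧
    -- behaviour off the closure of the union of the non-escaping sets
    (∀ z ∉ closure (⋃ Λ : ℕ → M, F.nonescaping ε Λ), 0 < F.averageGreen ν ε z) ∧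
    RandomHenon.PluriharmonicOn (F.averageGreen ν ε)
      (closure (⋃ Λ : ℕ → M, F.nonescaping ε Λ))ᶜ ∧
    -- the zero set
    (∀ z ∈ ⋂ Λ : ℕ → M, F.nonescaping ε Λ, F.averageGreen ν ε z = 0) ∧
    (ν.IsOpenPosMeasure →
      {z | F.averageGreen ν ε z = 0} = ⋂ Λ : ℕ → M, F.nonescaping ε Λ) := by
  have : CompactSpace M := isCompact_iff_compactSpace.1 hM
  obtain ⟨s, R, hR, h⟩ := F.exists_henonLike ε
  have hD := F.two_le_degree
  have hmem := F.mem_nonescaping_iff hR h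
  have hesc : ∀ z ∈ (closure (⋃ Λ : ℕ → M, F.nonescaping ε Λ))ᶜ, ∀ Λ : ℕ → M,
      ∃ n, RandomHenon.orbit (fun t z => (F.map t ^ (ε : ℤ)) z) Λ n z ∈ RandomHenon.cone s R := by
    intro z hz Λ
    by_contra! hn
    exact hz (subset_closure (Set.mem_iUnion.2 ⟨Λ, (hmem Λ z).2 hn⟩))
  have hzero : ∀ z ∈ ⋂ Λ : ℕ → M, F.nonescaping ε Λ, F.averageGreen ν ε z = 0 := by
    intro z hz
    rw [F.averageGreen_eq]
    refine integral_eq_zero_of_ae (Eventually.of_forall fun Λ => ?_)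
    exact h.escapeRate_eq_zero hR hD ((hmem Λ z).1 (Set.mem_iInter.1 hz Λ))
  refine ⟨fun Λ z => ?_, fun z => ?_, ?_, ?_, fun z hz => ?_, ?_, hzero, fun hν => ?_⟩
  · simp only [F.greenApprox_eq, F.green_eq]
    exact h.tendsto_escapeApprox hR hD Λ z
  · simp only [F.green_eq]
    exact h.integrable_escapeRate hR hD _ z
  · rw [F.averageGreen_eq]
    exact h.locallyHolder_integral hR hD _
  · rw [F.averageGreen_eq]
    exact h.plurisubharmonic_integral hR hD _
  · have hpos : ∀ Λ : ℕ → M, 0 < RandomHenon.escapeRate (fun t z => (F.map t ^ (ε : ℤ)) z)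
        F.degree Λ z := fun Λ => by
      obtain ⟨n, hn⟩ := hesc z hz Λ
      exact h.escapeRate_pos hR hD hn
    rw [F.averageGreen_eq, integral_pos_iff_support_of_nonneg (fun Λ => (hpos Λ).le)
      (h.integrable_escapeRate hR hD _ z)]
    rw [Function.support_eq_univ fun Λ => (hpos Λ).ne']
    simp
  · rw [F.averageGreen_eq]
    exact h.pluriharmonicOn_integral hR hD _ isClosed_closure.isOpen_compl hesc
  · refine Set.Subset.antisymm (fun z hz => ?_) hzero
    by_contra hz'
    simp only [Set.mem_iInter, not_forall] at hz'
    obtain ⟨Λ, hΛ⟩ := hz'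
    rw [hmem] at hΛ
    push Not at hΛ
    obtain ⟨n, hn⟩ := hΛ
    have := RandomHenon.isOpenPosMeasure_infinitePi ν
    have hcont := h.continuous_escapeRate_comp hR hD (X := ℕ → M) continuous_id
      (continuous_const (y := z))
    -- The sequence space is compact, so compact support is automatic; one parameter sequence with
    -- positive escape rate already makes the integral positive.
    refine (hcont.integral_pos_of_hasCompactSupport_nonneg_nonzero
      (μ := Measure.infinitePi fun _ : ℕ => ν) (HasCompactSupport.of_compactSpace _)
      (fun Λ => h.escapeRate_nonneg hR hD Λ z) (h.escapeRate_pos hR hD hn).ne').ne' ?_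
    have hz0 : F.averageGreen ν ε z = 0 := hz
    rwa [F.averageGreen_eq] at hz0
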